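/- Let $q$ be a prime power. A quantum code with parameters $[[n,K,d]]_q$ is a $q^K$-dimensional subspace of $(\mathbb{C}^q)^{\otimes n}$ with minimum distance $d$, i.e. it detects every error acting on fewer than $d$ of the $n$ qudits, but not every error acting on at most $d$ qudits (for $K=0$, as usual, detection is required to be pure: every traceless error on fewer than $d$ qudits has expectation $0$). It is called MDS if it attains the quantum Singleton bound, $n=K+2d-2$. (I) Let $N$ and $k$ be integers with $1\le k\le \left\lfloor \frac{N+q-1}{q+1}\right\rfloor$, and assume that one of the following conditions holds: i) $(N-1)\mid (q^2-1)$; ii) $N=(t+1)n+1$ for some positive integers $n,t$ with $n\mid (q^2-1)$ and $1\le t\le \frac{q-1}{n_2}-1$, where $n_2=\frac{n}{\gcd(n,q+1)}$; iii) $N=tq$ for some integer $t$ with $1\le t\le q$. Then: 1) there exists an MDS quantum code with parameters $[[N,N-2k,k+1]]_q$; 2) if $k(q+1)=N-1$, there exists an MDS quantum code with parameters $[[N+1,N-2k-1,k+2]]_q$; 3) if $N-1+q\ne k(q+1)\ne N-1$, there exists an MDS quantum code with parameters $[[N',N'-2k-2,k+2]]_q$, where $N'=N$ or $N'=N+1$.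 (II) Let $n$ be a positive integer with $(n-1)\mid(q^2-1)$ and put $k_0=\left\lfloor\frac{n+q-1}{q+1}\right\rfloor$. If $(n-1)\nmid k_0(q+1)$, $(n-1)\nmid (k_0+1)(q+1)$ and $2k_0+q\le n$, then there exists an MDS quantum code with parameters $[[n',n'-2k,k+1]]_q$ with $k=k_0+2$, where $n'=n$ or $n'=n+1$. -/

import Mathlib

open scoped Matrix

/-- The state space `(ℂ^q)^{⊗ n}` of `n` qudits of dimension `q`, written in the computational
basis: a vector is the family of its `q ^ n` amplitudes, indexed by the words of length `n` over
an alphabet with `q` letters. The Hermitian inner product of `φ` and `ψ` is `star φ ⬝ᵥ ψ`. -/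
abbrev QuditSpace (q n : ℕ) : Type := (Fin n → Fin q) → ℂ

/-- A linear operator on the space of `n` qudits, as a matrix in the computational basis. -/
abbrev QuditOperator (q n : ℕ) : Type := Matrix (Fin n → Fin q) (Fin n → Fin q) ℂ

/-- The operator `E` acts only on the qudits in `S`: it has the form `M ⊗ 1`, with `M` an
arbitrary operator on the qudits in `S` and `1` the identity on the remaining qudits.
The errors of weight at most `w` are spanned by the operators acting only on some `S` with
at most `w` elements. -/
def ActsOnlyOn {q n : ℕ} (S : Finset (Fin n)) (E : QuditOperator q n) : Prop :=
  ∃ M : Matrix (S → Fin q) (S → Fin q) ℂ, ∀ x y : Fin n → Fin q,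
    ((∀ i, i ∉ S → x i = y i) → E x y = M (fun i => x i) (fun i => y i)) ∧
    ((¬ ∀ i, i ∉ S → x i = y i) → E x y = 0)

/-- The Knill–Laflamme condition: the code `Q` detects the error `E`, that is, the compression of
`E` to `Q` is a scalar. -/
def DetectsError {q n : ℕ} (Q : Submodule ℂ (QuditSpace q n)) (E : QuditOperator q n) : Prop :=
  ∃ c : ℂ, ∀ φ ∈ Q, ∀ ψ ∈ Q, star φ ⬝ᵥ (E *ᵥ ψ) = c * (star φ ⬝ᵥ ψ)

/-- The scalar of the Knill–Laflamme condition is the normalised trace of `E`; it is `0` for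
every traceless error. -/
def DetectsPurely {q n : ℕ} (Q : Submodule ℂ (QuditSpace q n)) (E : QuditOperator q n) : Prop :=
  ∀ φ ∈ Q, ∀ ψ ∈ Q,
    star φ ⬝ᵥ (E *ᵥ ψ) = (E.trace / (q : ℂ) ^ n) * (star φ ⬝ᵥ ψ)

/-- The code `Q` has minimum distance at least `d`: it detects every error on fewer than `d`
qudits. A one-dimensional code detects every error, so for such a code the usual convention
is applied, namely that the detection has to be pure. -/
def QuantumDistanceAtLeast {q n : ℕ} (Q : Submodule ℂ (QuditSpace q n)) (d : ℕ) : Prop :=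
  ∀ S : Finset (Fin n), S.card < d → ∀ E : QuditOperator q n, ActsOnlyOn S E →
    DetectsError Q E ∧ (Module.finrank ℂ Q = 1 → DetectsPurely Q E)

/-- `Q` is a quantum code with parameters `[[n, K, d]]_q`: a subspace of dimension `q ^ K` of the
space of `n` qudits of dimension `q`, with minimum distance exactly `d`. -/
def IsQuantumCode (q n K d : ℕ) (Q : Submodule ℂ (QuditSpace q n)) : Prop :=
  Module.finrank ℂ Q = q ^ K ∧ QuantumDistanceAtLeast Q d ∧ ¬ QuantumDistanceAtLeast Q (d + 1)

/-- There is an MDS quantum code with parameters `[[n, K, d]]_q`, that is, a quantum code with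
these parameters which attains the quantum Singleton bound `n ≥ K + 2 d - 2`. -/
def ExistsQuantumMDSCode (q n K d : ℕ) : Prop :=
  n + 2 = K + 2 * d ∧ ∃ Q : Submodule ℂ (QuditSpace q n), IsQuantumCode q n K d Q

/-- The conditions on the length `N`. In the second one, the bound
`t ≤ (q - 1) / n₂ - 1`, with `n₂ = n / gcd (n, q + 1)`, is read in the rational numbers. -/
def AdmissibleLength (q N : ℕ) : Prop :=
  (N - 1) ∣ (q ^ 2 - 1) ∨
  (∃ n t : ℕ, N = (t + 1) * n + 1 ∧ n ∣ (q ^ 2 - 1) ∧ 1 ≤ t ∧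
    (t : ℚ) ≤ ((q : ℚ) - 1) / ((n / Nat.gcd n (q + 1) : ℕ) : ℚ) - 1) ∨
  (∃ t : ℕ, N = t * q ∧ 1 ≤ t ∧ t ≤ q)

/-!
Quantum MDS codes from classical MDS codes which are self-orthogonal for the Hermitian form.

**From classical to quantum codes.** Let `F ⊆ K` be the fields with `q` and `q ^ 2` elements. In
suitable `F`-coordinates on `K` the form `x y^q - x^q y` is the standard symplectic form, so that a
`K`-linear code of length `n` and dimension `k` contained in its Hermitian dual indexes a family of
commuting Weyl operators. These have a common eigenvector; the quantum code is the joint eigenspace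
for its eigenvalues, which avoids any choice of phases (delicate in characteristic two). Its
dimension `q ^ (n - 2 k)` is the trace of the averaging projector. If the classical code is MDS, it
takes all values on any `k` coordinates, so that averaging the conjugates of an operator on at most
`k` qudits by stabilizer elements yields its normalised trace, while the compression to the code
does not change: such operators are purely detected (`detectsPurely_stabilizerCode`). On any `k + 1`
qudits there is a Weyl operator which commutes with the stabilizer; it acts on the code without
being detected, or, if `n = 2 k`, without being purely detected. The outcome is
`existsQuantumMDSCode_of_generator`.

**Reed–Solomon codes.** For points `a` of `K` with non-zero weights `w a ∈ F`, write
`w a = v a ^ (q + 1)`. The words `(v a * f a)` with `deg f < k` form an MDS code, and the Hermitian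
product of the words of `x^i` and `x^j` is the moment `∑ w a * a ^ (i + q j)`. Conjugation exchanges
`i` and `j`, so that only `j ≤ i` matters. If the sole non-zero product is that of `x^(k-1)` with
itself, adding the point at infinity with the opposite weight makes the code self-orthogonal; this
is where the alternative between lengths `N` and `N + 1` comes from
(`existsQuantumMDSCode_of_moments`).

**Part (I).** By Lagrange interpolation, the weights `1 / f' a` on the `N` roots of `f` have
vanishing moments of order less than `N - 1`, and a non-zero moment of order `N - 1`. They lie in
`F`, up to a common factor, for `f = X ∏ (X^n - c)` with `c ∈ F` and for `f = ∏ (X^q - X - c)` with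
`c` of trace zero, which covers the admissible lengths (`AdmissibleLength.isLagrangeLength`). The
rest is a comparison of exponents.

**Part (II).** On zero and the `m`-th roots of unity, where `m = n - 1`, all moments vanish except
those of positive order divisible by `m`, and no exponent `i + q j` that occurs is a multiple of `m`
(`not_dvd_exponent`) except for `q = 5` and `m = 8`. In this case the moment of order `3 + 5 = 8`
does not vanish, and the code is replaced by a code of length nine over the field with 25 elements
built from a circulant matrix (`existsQuantumMDSCode_nine`).
-/

/-! ### Common eigenvectors -/

/-- In a minimal non-zero subspace invariant under the family, each operator is a scalar. -/
theorem exists_common_eigenvector {V ι : Type*} [AddCommGroup V] [Module ℂ V]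
    [FiniteDimensional ℂ V] [Nontrivial V] (f : ι → Module.End ℂ V)
    (hf : ∀ i j, Commute (f i) (f j)) :
    ∃ v : V, v ≠ 0 ∧ ∃ μ : ι → ℂ, ∀ i, f i v = μ i • v := by
  classical
  let P : ℕ → Prop := fun d => ∃ U : Submodule ℂ V, U ≠ ⊥ ∧ (∀ i, ∀ x ∈ U, f i x ∈ U) ∧
    Module.finrank ℂ U = d
  have hP : ∃ d, P d := ⟨_, ⊤, top_ne_bot, by simp, rfl⟩
  obtain ⟨U, hU, hinv, hd⟩ := Nat.find_spec hP
  have hscalar : ∀ i, ∃ μ : ℂ, ∀ x ∈ U, f i x = μ • x := by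
    intro i
    have : Nontrivial U := Submodule.nontrivial_iff_ne_bot.mpr hU
    obtain ⟨μ, hμ⟩ := Module.End.exists_eigenvalue ((f i).restrict (hinv i))
    obtain ⟨⟨x, hxU⟩, hx⟩ := hμ.exists_hasEigenvector
    have hx0 : x ≠ 0 := fun h => hx.2 (Subtype.ext h)
    have hxe : f i x = μ • x := congrArg Subtype.val hx.apply_eq_smul
    refine ⟨μ, ?_⟩
    let U' : Submodule ℂ V := U ⊓ Module.End.eigenspace (f i) μ
    have hxU' : x ∈ U' := ⟨hxU, Module.End.mem_eigenspace_iff.mpr hxe⟩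
    have hU' : U' ≠ ⊥ := fun h => hx0 (by simpa [h] using hxU')
    have hinv' : ∀ j, ∀ y ∈ U', f j y ∈ U' := by
      intro j y hy
      refine ⟨hinv j y hy.1, Module.End.mem_eigenspace_iff.mpr ?_⟩
      have h1 : f i (f j y) = f j (f i y) := LinearMap.congr_fun (hf i j).eq y
      rw [h1, Module.End.mem_eigenspace_iff.mp hy.2, map_smul]
    have hle : Module.finrank ℂ U ≤ Module.finrank ℂ U' :=
      hd.trans_le (Nat.find_min' hP ⟨U', hU', hinv', rfl⟩)
    have heq : U' = U := Submodule.eq_of_le_of_finrank_le inf_le_left hle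
    intro y hy
    rw [← heq] at hy
    exact Module.End.mem_eigenspace_iff.mp hy.2
  choose μ hμ using hscalar
  obtain ⟨v, hvU, hv⟩ := Submodule.exists_mem_ne_zero_of_ne_bot hU
  exact ⟨v, hv, μ, fun i => hμ i v hvU⟩

/-! ### Weyl operators -/

section Weyl

variable {F : Type*} {q n : ℕ} (e : F ≃ Fin q)

/-- The word `y`, its letters being read in the alphabet `F`. -/
def letters (y : Fin n → Fin q) : Fin n → F := fun i => e.symm (y i)

theorem letters_injective : Function.Injective (letters e : (Fin n → Fin q) → Fin n → F) := by
  intro x y h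
  funext i
  exact e.symm.injective (congrFun h i)

variable [Field F] (ψ : AddChar F ℂ)

/-- The translate by `a` of the word `y`, its letters being read in the alphabet `F`. -/
def translateWord (a : Fin n → F) (y : Fin n → Fin q) : Fin n → Fin q :=
  fun i => e (e.symm (y i) + a i)

@[simp] theorem letters_translateWord (a : Fin n → F) (y : Fin n → Fin q) :
    letters e (translateWord e a y) = letters e y + a := by
  ext i; simp [letters, translateWord]

theorem translateWord_translateWord (a b : Fin n → F) (y : Fin n → Fin q) :
    translateWord e a (translateWord e b y) = translateWord e (b + a) y :=
  letters_injective e (by simp [add_assoc])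

theorem translateWord_injective (a : Fin n → F) :
    Function.Injective (translateWord e a : (Fin n → Fin q) → _) := by
  intro x y h
  apply letters_injective e
  simpa using congrArg (letters e) h

theorem eq_translateWord_self_iff (a : Fin n → F) (y : Fin n → Fin q) :
    y = translateWord e a y ↔ a = 0 := by
  rw [← (letters_injective e).eq_iff]; simp

/-- The Weyl operator `X(a) Z(b)`, for `c = (a, b)`: it multiplies the basis vector of the word
`y` by `ψ (b ⬝ y)` and translates the word by `a`. -/
noncomputable def weyl (c : (Fin n → F) × (Fin n → F)) : QuditOperator q n := by
  classical
  exact fun x y => if x = translateWord e c.1 y then ψ (c.2 ⬝ᵥ letters e y) else 0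

theorem weyl_translateWord (c : (Fin n → F) × (Fin n → F)) (y : Fin n → Fin q) :
    weyl e ψ c (translateWord e c.1 y) y = ψ (c.2 ⬝ᵥ letters e y) := by
  simp [weyl]

theorem weyl_of_ne (c : (Fin n → F) × (Fin n → F)) {x y : Fin n → Fin q}
    (h : x ≠ translateWord e c.1 y) : weyl e ψ c x y = 0 := by
  simp [weyl, h]

theorem weyl_mul (c d : (Fin n → F) × (Fin n → F)) :
    weyl e ψ c * weyl e ψ d = ψ (c.2 ⬝ᵥ d.1) • weyl e ψ (c + d) := by
  ext x z
  rw [Matrix.mul_apply, Finset.sum_eq_single (translateWord e d.1 z)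
    (fun y _ hy => by rw [weyl_of_ne e ψ d hy, mul_zero]) (by simp), weyl_translateWord,
    Matrix.smul_apply, smul_eq_mul]
  by_cases hx : x = translateWord e (c + d).1 z
  · have hx' : x = translateWord e c.1 (translateWord e d.1 z) := by
      rw [hx, translateWord_translateWord, Prod.fst_add, add_comm]
    conv_lhs => rw [hx']
    conv_rhs => rw [hx]
    rw [weyl_translateWord, weyl_translateWord, ← AddChar.map_add_eq_mul, ← AddChar.map_add_eq_mul]
    simp only [letters_translateWord, dotProduct_add, add_dotProduct, Prod.snd_add]
    congr 1
    ring
  · rw [weyl_of_ne e ψ _ hx, weyl_of_ne, zero_mul, mul_zero]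
    rwa [translateWord_translateWord, ← Prod.fst_add, add_comm d c]

theorem weyl_zero : weyl e ψ (0 : (Fin n → F) × (Fin n → F)) = 1 := by
  ext x y
  have h : translateWord e (0 : Fin n → F) y = y := ((eq_translateWord_self_iff e 0 y).mpr rfl).symm
  simp [weyl, Matrix.one_apply, h]

theorem weyl_commute {c d : (Fin n → F) × (Fin n → F)} (h : c.2 ⬝ᵥ d.1 = d.2 ⬝ᵥ c.1) :
    Commute (weyl e ψ c) (weyl e ψ d) := by
  rw [Commute, SemiconjBy, weyl_mul, weyl_mul, h, add_comm]

theorem trace_weyl_zero : (weyl e ψ (0 : (Fin n → F) × (Fin n → F))).trace = (q : ℂ) ^ n := by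
  rw [weyl_zero]; simp

variable [Fintype F]

theorem sum_char_dotProduct {ι : Type*} [Fintype ι] [DecidableEq ι] (hψ : ψ.IsPrimitive)
    {v : ι → F} (hv : v ≠ 0) : ∑ t : ι → F, ψ (t ⬝ᵥ v) = 0 := by
  classical
  obtain ⟨i, hi⟩ := Function.ne_iff.mp hv
  let χ : AddChar (ι → F) ℂ := ψ.compAddMonoidHom
    { toFun := fun t => t ⬝ᵥ v, map_zero' := zero_dotProduct v,
      map_add' := fun s t => add_dotProduct s t v }
  refine AddChar.sum_eq_zero_of_ne_one (ψ := χ) fun h => hψ hi ?_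
  ext x
  have := DFunLike.congr_fun h (Pi.single i x)
  simpa [χ, mul_comm, AddChar.mulShift_apply] using this

/-- The Weyl operators other than the identity have trace zero. -/
theorem trace_weyl (hψ : ψ.IsPrimitive) {c : (Fin n → F) × (Fin n → F)} (hc : c ≠ 0) :
    (weyl e ψ c).trace = 0 := by
  classical
  rw [Matrix.trace]
  by_cases h1 : c.1 = 0
  · have h2 : c.2 ≠ 0 := fun h2 => hc (Prod.ext h1 h2)
    have h3 : ∀ x, (weyl e ψ c).diag x = ψ (letters e x ⬝ᵥ c.2) := fun x => by
      have hx : x = translateWord e c.1 x := (eq_translateWord_self_iff e _ x).mpr h1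
      rw [Matrix.diag_apply, dotProduct_comm, ← weyl_translateWord, ← hx]
    simp_rw [h3]
    rw [← sum_char_dotProduct ψ hψ h2]
    exact Fintype.sum_equiv (Equiv.arrowCongr (Equiv.refl (Fin n)) e.symm) _ _ (fun x => rfl)
  · refine Finset.sum_eq_zero fun x _ => ?_
    exact weyl_of_ne e ψ c (fun hx => h1 ((eq_translateWord_self_iff e _ x).mp hx))

theorem conj_char (x : F) : star (ψ x) = ψ (-x) := by
  have h : 0 < ringChar F := by
    obtain ⟨p, hp⟩ := CharP.exists F
    have := CharP.char_is_prime F p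
    rw [ringChar.eq F p]; exact this.pos
  exact (AddChar.starComp_apply h x).trans (AddChar.inv_apply ψ x)

/-- Conjugation by a Weyl operator translates both arguments of a kernel and multiplies it
by a character. -/
theorem weyl_conj_apply (c : (Fin n → F) × (Fin n → F)) (E : QuditOperator q n)
    (x y : Fin n → Fin q) :
    ((weyl e ψ c)ᴴ * E * weyl e ψ c) x y =
      ψ (c.2 ⬝ᵥ (letters e y - letters e x)) *
        E (translateWord e c.1 x) (translateWord e c.1 y) := by
  classical
  rw [Matrix.mul_apply, Finset.sum_eq_single (translateWord e c.1 y)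
    (fun z _ hz => by rw [weyl_of_ne e ψ c hz, mul_zero]) (by simp), weyl_translateWord,
    Matrix.mul_apply, Finset.sum_eq_single (translateWord e c.1 x)
    (fun z _ hz => by rw [Matrix.conjTranspose_apply, weyl_of_ne e ψ c hz, star_zero, zero_mul])
    (by simp), Matrix.conjTranspose_apply, weyl_translateWord, conj_char, dotProduct_sub,
    sub_eq_neg_add, AddChar.map_add_eq_mul]
  ring

theorem weyl_conjTranspose_mul_self (c : (Fin n → F) × (Fin n → F)) :
    (weyl e ψ c)ᴴ * weyl e ψ c = 1 := by
  ext x y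
  have h := weyl_conj_apply e ψ c 1 x y
  rw [mul_one] at h
  rw [h, Matrix.one_apply, Matrix.one_apply]
  simp only [(translateWord_injective e c.1).eq_iff]
  split_ifs with hxy
  · simp [hxy]
  · simp

end Weyl

/-! ### Stabilizer codes -/

section Stabilizer

variable {F : Type*} [Field F] {q n : ℕ} (e : F ≃ Fin q) (ψ : AddChar F ℂ)
  {Γ : Type*} [AddCommGroup Γ] (γ : Γ →+ (Fin n → F) × (Fin n → F)) (μ : Γ → ℂ)

/-- The joint eigenspace of the Weyl operators of the elements `γ g`, with eigenvalues `μ g`. -/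
noncomputable def stabilizerCode : Submodule ℂ (QuditSpace q n) where
  carrier := {φ | ∀ g, weyl e ψ (γ g) *ᵥ φ = μ g • φ}
  zero_mem' := fun g => by simp
  add_mem' := fun {φ χ} hφ hχ g => by
    rw [Matrix.mulVec_add, hφ g, hχ g, smul_add]
  smul_mem' := fun c φ hφ g => by
    rw [Matrix.mulVec_smul, hφ g, smul_comm]

/-- A system of eigenvalues which is compatible with the multiplication of Weyl operators. -/
structure IsEigenvalueSystem : Prop where
  map_zero : μ 0 = 1
  mul : ∀ g h, μ g * μ h = ψ ((γ g).2 ⬝ᵥ (γ h).1) * μ (g + h)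
  star_mul_self : ∀ g, star (μ g) * μ g = 1

theorem dotProduct_conjTranspose_mul_mul {m : Type*} [Fintype m] (W E : Matrix m m ℂ)
    (φ χ : m → ℂ) : star φ ⬝ᵥ ((Wᴴ * E * W) *ᵥ χ) = star (W *ᵥ φ) ⬝ᵥ (E *ᵥ (W *ᵥ χ)) := by
  rw [Matrix.star_mulVec, ← Matrix.mulVec_mulVec, ← Matrix.mulVec_mulVec,
    Matrix.dotProduct_mulVec]

open scoped ComplexOrder in
theorem star_dotProduct_self_ne_zero {m : Type*} [Fintype m] {v : m → ℂ} (hv : v ≠ 0) :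
    star v ⬝ᵥ v ≠ 0 := fun h => hv (dotProduct_star_self_eq_zero.mp h)

/-- The Weyl operators of an isotropic code commute, so that they have a common eigenvector;
its eigenvalues form a compatible system. -/
theorem exists_isEigenvalueSystem [Fintype F] [NeZero q] (e : F ≃ Fin q)
    (hγ : ∀ g h, (γ g).2 ⬝ᵥ (γ h).1 = (γ h).2 ⬝ᵥ (γ g).1) :
    ∃ μ : Γ → ℂ, IsEigenvalueSystem ψ γ μ := by
  classical
  obtain ⟨v, hv, μ, hμ⟩ := exists_common_eigenvector
    (fun g : Γ => Matrix.toLinAlgEquiv' (weyl e ψ (γ g)))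
    (fun g h => (weyl_commute e ψ (hγ g h)).map Matrix.toLinAlgEquiv')
  replace hμ : ∀ g, weyl e ψ (γ g) *ᵥ v = μ g • v := fun g => by
    rw [← hμ g, Matrix.toLinAlgEquiv'_apply]
  refine ⟨μ, ?_, fun g h => ?_, fun g => ?_⟩
  · have h := hμ 0
    rw [map_zero, weyl_zero, Matrix.one_mulVec] at h
    exact smul_left_injective ℂ hv (by simpa using h.symm)
  · have h1 : weyl e ψ (γ g) *ᵥ (weyl e ψ (γ h) *ᵥ v) = (μ g * μ h) • v := by
      rw [hμ h, Matrix.mulVec_smul, hμ g, smul_smul, mul_comm]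
    rw [Matrix.mulVec_mulVec, weyl_mul, ← map_add, Matrix.smul_mulVec, hμ, smul_smul] at h1
    exact smul_left_injective ℂ hv h1.symm
  · have h1 := dotProduct_conjTranspose_mul_mul (weyl e ψ (γ g)) 1 v v
    rw [mul_one, weyl_conjTranspose_mul_self, Matrix.one_mulVec, Matrix.one_mulVec, hμ, star_smul,
      smul_dotProduct, dotProduct_smul, smul_smul, smul_eq_mul] at h1
    exact (mul_right_cancel₀ (star_dotProduct_self_ne_zero hv) ((one_mul _).trans h1)).symm

variable {ψ γ μ}

theorem IsEigenvalueSystem.ne_zero (hμ : IsEigenvalueSystem ψ γ μ) (g : Γ) : μ g ≠ 0 :=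
  fun h => by simpa [h] using hμ.star_mul_self g

/-- A Weyl operator which commutes with the stabilizer maps the code to itself, so that it is
detected only if it acts as a scalar. -/
theorem weyl_mulVec_eq_smul_of_detected
    {u : (Fin n → F) × (Fin n → F)} (hu : ∀ g, (γ g).2 ⬝ᵥ u.1 = u.2 ⬝ᵥ (γ g).1) {c : ℂ}
    (hc : ∀ φ ∈ stabilizerCode e ψ γ μ, ∀ χ ∈ stabilizerCode e ψ γ μ,
      star φ ⬝ᵥ (weyl e ψ u *ᵥ χ) = c * (star φ ⬝ᵥ χ))
    {χ : QuditSpace q n} (hχ : χ ∈ stabilizerCode e ψ γ μ) : weyl e ψ u *ᵥ χ = c • χ := by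
  have h1 : weyl e ψ u *ᵥ χ - c • χ ∈ stabilizerCode e ψ γ μ := by
    refine Submodule.sub_mem _ (fun g => ?_) (Submodule.smul_mem _ _ hχ)
    rw [Matrix.mulVec_mulVec, (weyl_commute e ψ (hu g)).eq, ← Matrix.mulVec_mulVec, hχ g,
      Matrix.mulVec_smul]
  by_contra h2
  refine star_dotProduct_self_ne_zero (sub_ne_zero.mpr h2) ?_
  rw [dotProduct_sub, hc _ h1 _ hχ, dotProduct_smul, smul_eq_mul, sub_self]

theorem scalar_ne_zero_of_weyl_mulVec_eq_smul [Fintype F] {u : (Fin n → F) × (Fin n → F)}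
    {c : ℂ} {χ : QuditSpace q n} (hχ : χ ≠ 0) (h : weyl e ψ u *ᵥ χ = c • χ) : c ≠ 0 := by
  rintro rfl
  apply hχ
  rw [← Matrix.one_mulVec χ, ← weyl_conjTranspose_mul_self e ψ u, ← Matrix.mulVec_mulVec, h,
    zero_smul, Matrix.mulVec_zero]

/-- Averaging over the stabilizer: if the code `γ` takes all possible values on the coordinates
in `S`, then the average of the conjugates of an operator on `S` by Weyl operators of the code is
a scalar, while each conjugate has the same compression to the stabilizer code. -/
theorem detectsPurely_stabilizerCode [Fintype F] (hμ : IsEigenvalueSystem ψ γ μ)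
    (hψ : ψ.IsPrimitive)
    {S : Finset (Fin n)} (hS : ∀ a b : S → F, ∃ g, ∀ i : S, (γ g).1 i = a i ∧ (γ g).2 i = b i)
    {E : QuditOperator q n} (hE : ActsOnlyOn S E) :
    DetectsPurely (stabilizerCode e ψ γ μ) E := by
  classical
  obtain ⟨M, hM⟩ := hE
  choose σ hσ using hS
  have hcard : Fintype.card F = q := by simpa using Fintype.card_congr e
  have hq : (q : ℂ) ≠ 0 := by rw [← hcard]; exact Nat.cast_ne_zero.mpr Fintype.card_ne_zero
  let T : QuditOperator q n :=
    ∑ a, ∑ b, (weyl e ψ (γ (σ a b)))ᴴ * E * weyl e ψ (γ (σ a b))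
  -- the sum over `b` kills the off-diagonal entries, the sum over `a` averages the diagonal
  have hT : T = ((q : ℂ) ^ S.card * M.trace) • (1 : QuditOperator q n) := by
    ext x y
    simp only [T, Matrix.sum_apply, weyl_conj_apply, Matrix.smul_apply, smul_eq_mul,
      Matrix.one_apply]
    by_cases hxy : ∀ i, i ∉ S → x i = y i
    · have h1 : ∀ a b, E (translateWord e (γ (σ a b)).1 x) (translateWord e (γ (σ a b)).1 y)
          = M (fun i => e (e.symm (x i) + a i)) (fun i => e (e.symm (y i) + a i)) := by
        intro a b
        rw [(hM _ _).1 (fun i hi => by simp [translateWord, hxy i hi])]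
        simp only [translateWord, hσ]
      have h2 : ∀ a b, (γ (σ a b)).2 ⬝ᵥ (letters e y - letters e x)
          = b ⬝ᵥ (fun i : S => letters e y i - letters e x i) := by
        intro a b
        rw [dotProduct, dotProduct, ← Finset.sum_subset (Finset.subset_univ S)
          (fun i _ hi => by simp [letters, hxy i hi]), ← Finset.sum_coe_sort]
        exact Finset.sum_congr rfl fun i _ => by rw [(hσ a b i).2]; rfl
      simp_rw [h1, h2, ← Finset.sum_mul]
      by_cases hxy' : x = y
      · subst hxy'
        have h3 : (fun i : S => letters e x i - letters e x i) = 0 := by ext; simp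
        simp only [h3, dotProduct_zero, AddChar.map_zero_eq_one, Finset.sum_const,
          Finset.card_univ, ← Finset.mul_sum, if_true, mul_one]
        congr 1
        · simp [hcard]
        · let w : (S → F) ≃ (S → Fin q) := (Equiv.addLeft (fun i : S => e.symm (x i))).trans
            (Equiv.arrowCongr (Equiv.refl S) e)
          exact Fintype.sum_equiv w _ (fun z => M z z) (fun a => rfl)
      · have h3 : (fun i : S => letters e y i - letters e x i) ≠ 0 := by
          intro h
          refine hxy' (funext fun i => ?_)
          by_cases hi : i ∈ S
          · exact (e.symm.injective (sub_eq_zero.mp (congrFun h ⟨i, hi⟩))).symm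
          · exact hxy i hi
        simp [sum_char_dotProduct ψ hψ h3, hxy']
    · have hne : x ≠ y := fun h => hxy fun i _ => congrFun h i
      rw [if_neg hne, mul_zero]
      refine Finset.sum_eq_zero fun a _ => Finset.sum_eq_zero fun b _ => ?_
      rw [(hM _ _).2, mul_zero]
      intro h
      refine hxy fun i hi => ?_
      simpa [translateWord] using h i hi
  have htr : ∀ c : (Fin n → F) × (Fin n → F),
      ((weyl e ψ c)ᴴ * E * weyl e ψ c).trace = E.trace := by
    intro c
    rw [Matrix.trace_mul_comm, ← mul_assoc, mul_eq_one_comm.mp (weyl_conjTranspose_mul_self e ψ c),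
      one_mul]
  have hTtr : T.trace = (q : ℂ) ^ S.card * (q : ℂ) ^ S.card * E.trace := by
    simp only [T, Matrix.trace_sum, htr, Finset.sum_const, Finset.card_univ, nsmul_eq_mul]
    simp [hcard, mul_assoc]
  have hMtr : (q : ℂ) ^ S.card * M.trace =
      (q : ℂ) ^ S.card * (q : ℂ) ^ S.card * (E.trace / (q : ℂ) ^ n) := by
    rw [hT, Matrix.trace_smul, Matrix.trace_one] at hTtr
    have h4 : ((Fintype.card (Fin n → Fin q) : ℕ) : ℂ) = (q : ℂ) ^ n := by simp
    rw [h4, smul_eq_mul] at hTtr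
    rw [mul_div_assoc', ← hTtr, mul_div_cancel_right₀ _ (pow_ne_zero n hq)]
  intro φ hφ χ hχ
  have hcomp : ∀ g, star φ ⬝ᵥ (((weyl e ψ (γ g))ᴴ * E * weyl e ψ (γ g)) *ᵥ χ)
      = star φ ⬝ᵥ (E *ᵥ χ) := by
    intro g
    rw [dotProduct_conjTranspose_mul_mul, hφ g, hχ g, Matrix.mulVec_smul, star_smul,
      smul_dotProduct, dotProduct_smul, smul_smul, hμ.star_mul_self, one_smul]
  have h5 : star φ ⬝ᵥ (T *ᵥ χ) = (q : ℂ) ^ S.card * (q : ℂ) ^ S.card * (star φ ⬝ᵥ (E *ᵥ χ)) := by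
    simp only [T, Matrix.sum_mulVec, dotProduct_sum, hcomp, Finset.sum_const, Finset.card_univ,
      nsmul_eq_mul]
    simp [hcard, mul_assoc]
  rw [hT, hMtr, Matrix.smul_mulVec, Matrix.one_mulVec, dotProduct_smul, smul_eq_mul, mul_assoc]
    at h5
  exact (mul_left_cancel₀ (mul_ne_zero (pow_ne_zero _ hq) (pow_ne_zero _ hq)) h5).symm

variable [Fintype Γ]

variable (ψ γ μ) in
/-- The projector onto the stabilizer code, as an average of Weyl operators. -/
noncomputable def stabilizerProjector : QuditOperator q n :=
  (Fintype.card Γ : ℂ)⁻¹ • ∑ g, (μ g)⁻¹ • weyl e ψ (γ g)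

theorem weyl_mul_stabilizerProjector (hμ : IsEigenvalueSystem ψ γ μ) (g : Γ) :
    weyl e ψ (γ g) * stabilizerProjector e ψ γ μ = μ g • stabilizerProjector e ψ γ μ := by
  rw [stabilizerProjector, Matrix.mul_smul, smul_comm, Finset.mul_sum,
    Finset.smul_sum (r := μ g)]
  congr 1
  refine Fintype.sum_equiv (Equiv.addLeft g) _ _ fun h => ?_
  rw [Matrix.mul_smul, weyl_mul, ← map_add, smul_smul, smul_smul, Equiv.coe_addLeft]
  congr 1
  have h1 := hμ.mul g h
  have h2 := hμ.ne_zero h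
  have h3 := hμ.ne_zero (g + h)
  field_simp
  rw [mul_comm (μ h), h1, mul_comm]

theorem isProj_stabilizerProjector (hμ : IsEigenvalueSystem ψ γ μ) :
    LinearMap.IsProj (stabilizerCode e ψ γ μ) (Matrix.toLin' (stabilizerProjector e ψ γ μ)) := by
  refine ⟨fun φ g => ?_, fun φ hφ => ?_⟩
  · rw [Matrix.toLin'_apply, Matrix.mulVec_mulVec, weyl_mul_stabilizerProjector e hμ,
      Matrix.smul_mulVec]
  · have h1 : ∀ g : Γ, ((μ g)⁻¹ • weyl e ψ (γ g)) *ᵥ φ = φ := fun g => by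
      rw [Matrix.smul_mulVec, hφ g, smul_smul, inv_mul_cancel₀ (hμ.ne_zero g), one_smul]
    rw [Matrix.toLin'_apply, stabilizerProjector, Matrix.smul_mulVec, Matrix.sum_mulVec]
    simp_rw [h1]
    rw [Finset.sum_const, Finset.card_univ, ← Nat.cast_smul_eq_nsmul ℂ, smul_smul,
      inv_mul_cancel₀ (Nat.cast_ne_zero.mpr Fintype.card_ne_zero), one_smul]

variable [Fintype F]

theorem finrank_stabilizerCode_mul_card (hμ : IsEigenvalueSystem ψ γ μ) (hψ : ψ.IsPrimitive)
    (hγ : Function.Injective γ) :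
    Module.finrank ℂ (stabilizerCode e ψ γ μ) * Fintype.card Γ = q ^ n := by
  have h := (isProj_stabilizerProjector e hμ).trace
  rw [Matrix.trace_toLin'_eq, stabilizerProjector, Matrix.trace_smul, Matrix.trace_sum,
    Finset.sum_eq_single 0 (fun g _ hg => by
      rw [Matrix.trace_smul, trace_weyl e ψ hψ ((map_ne_zero_iff γ hγ).mpr hg), smul_zero])
    (by simp), hμ.map_zero, map_zero, inv_one, one_smul, trace_weyl_zero, smul_eq_mul] at h
  have h1 : (Fintype.card Γ : ℂ) ≠ 0 := Nat.cast_ne_zero.mpr Fintype.card_ne_zero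
  have h2 : ((Module.finrank ℂ (stabilizerCode e ψ γ μ) * Fintype.card Γ : ℕ) : ℂ)
      = ((q ^ n : ℕ) : ℂ) := by
    push_cast
    rw [← h]
    field_simp
  exact_mod_cast h2

/-- A Weyl operator that acts as a non-zero scalar on the stabilizer code comes from the
stabilizer, since otherwise its product with the projector has trace zero. -/
theorem mem_range_of_weyl_mulVec_eq_smul (hμ : IsEigenvalueSystem ψ γ μ) (hψ : ψ.IsPrimitive)
    {u : (Fin n → F) × (Fin n → F)} {c : ℂ} (hc : c ≠ 0)
    (hQ : stabilizerCode e ψ γ μ ≠ ⊥)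
    (h : ∀ χ ∈ stabilizerCode e ψ γ μ, weyl e ψ u *ᵥ χ = c • χ) : ∃ g, γ g = u := by
  by_contra hu
  have hP := isProj_stabilizerProjector e hμ
  have h1 : weyl e ψ u * stabilizerProjector e ψ γ μ = c • stabilizerProjector e ψ γ μ := by
    refine Matrix.toLin'.injective (LinearMap.ext fun χ => ?_)
    have := h _ (hP.map_mem χ)
    rw [Matrix.toLin'_apply] at this
    rw [Matrix.toLin'_apply, Matrix.toLin'_apply, ← Matrix.mulVec_mulVec, this,
      Matrix.smul_mulVec]
  have h2 : (weyl e ψ u * stabilizerProjector e ψ γ μ).trace = 0 := by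
    rw [stabilizerProjector, Matrix.mul_smul, Matrix.trace_smul, Finset.mul_sum, Matrix.trace_sum,
      Finset.sum_eq_zero, smul_zero]
    intro g _
    rw [Matrix.mul_smul, weyl_mul, Matrix.trace_smul, Matrix.trace_smul, trace_weyl e ψ hψ,
      smul_zero, smul_zero]
    intro h0
    exact hu ⟨-g, by rw [map_neg, eq_comm]; exact eq_neg_of_add_eq_zero_left h0⟩
  have h3 := hP.trace
  rw [Matrix.trace_toLin'_eq] at h3
  rw [h1, Matrix.trace_smul, h3, smul_eq_mul, mul_eq_zero, Nat.cast_eq_zero] at h2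
  exact hQ (Submodule.finrank_eq_zero.mp (h2.resolve_left hc))

end Stabilizer

/-! ### Quantum MDS codes from stabilizers -/

section StabilizerParameters

variable {F : Type*} [Field F] {q n : ℕ} (e : F ≃ Fin q) (ψ : AddChar F ℂ)

theorem actsOnlyOn_weyl {S : Finset (Fin n)} {c : (Fin n → F) × (Fin n → F)}
    (hc : ∀ i, i ∉ S → c.1 i = 0 ∧ c.2 i = 0) : ActsOnlyOn S (weyl e ψ c) := by
  classical
  refine ⟨fun s t => if ∀ i : S, e.symm (s i) = e.symm (t i) + c.1 i then
    ψ (∑ i : S, c.2 i * e.symm (t i)) else 0, fun x y => ⟨fun hxy => ?_, fun hxy => ?_⟩⟩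
  · have h1 : x = translateWord e c.1 y ↔ ∀ i : S, e.symm (x i) = e.symm (y i) + c.1 i := by
      constructor
      · intro h i
        conv_lhs => rw [h]
        simp [translateWord]
      · intro h
        funext i
        apply e.symm.injective
        by_cases hi : i ∈ S
        · simpa [translateWord] using h ⟨i, hi⟩
        · simp [translateWord, hxy i hi, (hc i hi).1]
    have h2 : c.2 ⬝ᵥ letters e y = ∑ i : S, c.2 i * e.symm (y i) := by
      rw [dotProduct, ← Finset.sum_subset (Finset.subset_univ S)
        (fun i _ hi => by simp [(hc i hi).2]), ← Finset.sum_coe_sort]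
      rfl
    simp only [weyl, h1, h2]
  · refine weyl_of_ne e ψ c fun h => hxy fun i hi => ?_
    apply e.symm.injective
    rw [h]
    simp [translateWord, (hc i hi).1]

variable [Fintype F]

/-- A stabilizer code is a quantum MDS code if its stabilizer takes all values on any `k`
coordinates, while some Weyl operator on `k + 1` qudits commutes with the stabilizer without
belonging to it. For `n = 2 k` the code is one-dimensional and the operator may belong to the
stabilizer: having trace zero, it is then not purely detected. -/
theorem existsQuantumMDSCode_of_stabilizer (hF : Fintype.card F = q) {Γ : Type*} [AddCommGroup Γ]
    [Fintype Γ] {k : ℕ} (hΓ : Fintype.card Γ = q ^ (2 * k))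
    (γ : Γ →+ (Fin n → F) × (Fin n → F)) (hinj : Function.Injective γ)
    (hiso : ∀ g h, (γ g).2 ⬝ᵥ (γ h).1 = (γ h).2 ⬝ᵥ (γ g).1)
    (hsurj : ∀ S : Finset (Fin n), S.card ≤ k →
      ∀ a b : S → F, ∃ g, ∀ i : S, (γ g).1 i = a i ∧ (γ g).2 i = b i)
    (hu : 2 * k ≤ n → ∃ S : Finset (Fin n), S.card = k + 1 ∧
      ∃ u : (Fin n → F) × (Fin n → F), u ≠ 0 ∧ (∀ i, i ∉ S → u.1 i = 0 ∧ u.2 i = 0) ∧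
        (∀ g, (γ g).2 ⬝ᵥ u.1 = u.2 ⬝ᵥ (γ g).1) ∧ ((∃ g, γ g = u) → n ≤ 2 * k)) :
    ExistsQuantumMDSCode q n (n - 2 * k) (k + 1) := by
  have hq : 1 < q := hF ▸ Fintype.one_lt_card
  have : NeZero q := ⟨by omega⟩
  let e : F ≃ Fin q := Fintype.equivFinOfCardEq hF
  let ψ := AddChar.FiniteField.primitiveChar_to_Complex F
  have hψ : ψ.IsPrimitive := AddChar.FiniteField.primitiveChar_to_Complex_isPrimitive F
  obtain ⟨μ, hμ⟩ := exists_isEigenvalueSystem ψ γ e hiso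
  have hrank := finrank_stabilizerCode_mul_card e hμ hψ hinj
  rw [hΓ] at hrank
  set Q := stabilizerCode e ψ γ μ with hQ
  have hkn : 2 * k ≤ n := (Nat.pow_dvd_pow_iff_le_right hq).mp (Dvd.intro_left _ hrank)
  have hdim : Module.finrank ℂ Q = q ^ (n - 2 * k) := by
    refine Nat.eq_of_mul_eq_mul_right (pow_pos (by omega : 0 < q) (2 * k)) ?_
    rw [hrank, ← pow_add, Nat.sub_add_cancel hkn]
  have hne : Q ≠ ⊥ := by
    intro h
    rw [h, finrank_bot] at hdim
    exact (pow_pos (by omega : 0 < q) _).ne hdim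
  refine ⟨by omega, Q, hdim, fun S hS E hE => ?_, fun hd => ?_⟩
  · have h := detectsPurely_stabilizerCode e hμ hψ (hsurj S (by omega)) hE
    exact ⟨⟨_, h⟩, fun _ => h⟩
  · obtain ⟨S, hS, u, hu0, hsupp, hcomm, hmem⟩ := hu hkn
    obtain ⟨⟨c, hc⟩, hpure⟩ := hd S (by omega) _ (actsOnlyOn_weyl e ψ hsupp)
    obtain ⟨χ, hχ, hχ0⟩ := Submodule.exists_mem_ne_zero_of_ne_bot hne
    have hsc : ∀ c : ℂ, (∀ φ ∈ Q, ∀ χ ∈ Q,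
        star φ ⬝ᵥ (weyl e ψ u *ᵥ χ) = c * (star φ ⬝ᵥ χ)) → c ≠ 0 := fun c hc =>
      scalar_ne_zero_of_weyl_mulVec_eq_smul e hχ0 (weyl_mulVec_eq_smul_of_detected e hcomm hc hχ)
    have hn : n ≤ 2 * k := hmem (mem_range_of_weyl_mulVec_eq_smul e hμ hψ (hsc c hc) hne
      fun χ hχ => weyl_mulVec_eq_smul_of_detected e hcomm hc hχ)
    have hone : Module.finrank ℂ Q = 1 := by rw [hdim, Nat.sub_eq_zero_of_le hn, pow_zero]
    refine hsc _ (hpure hone) ?_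
    rw [trace_weyl e ψ hψ hu0, zero_div]

end StabilizerParameters

/-! ### The Hermitian construction -/

section Hermitian

theorem exists_pow_card_ne {K : Type*} [Field K] [Fintype K] {q : ℕ} (hq : 1 < q)
    (hK : Fintype.card K = q ^ 2) :
    ∃ θ : K, θ ^ q ≠ θ := by
  by_contra! h
  have h1 := FiniteField.X_pow_card_sub_X_natDegree_eq K hq
  have h2 := Polynomial.card_le_degree_of_subset_roots
    (p := (Polynomial.X ^ q - Polynomial.X : Polynomial K)) (Z := Finset.univ) (fun x _ => by
      rw [Polynomial.mem_roots (FiniteField.X_pow_card_sub_X_ne_zero K hq)]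
      simp [h x])
  rw [h1, Finset.card_univ, hK] at h2
  nlinarith

variable (F : Type*) {K : Type*} [Field F] [Fintype F] [Field K] [Algebra F K] {q n k : ℕ}

theorem add_pow_card_field (hF : Fintype.card F = q) (x y : K) :
    (x + y) ^ q = x ^ q + y ^ q := by
  subst hF; exact map_add (FiniteField.frobeniusAlgHom F K) x y

theorem sub_pow_card_field (hF : Fintype.card F = q) (x y : K) :
    (x - y) ^ q = x ^ q - y ^ q := by
  subst hF; exact map_sub (FiniteField.frobeniusAlgHom F K) x y

theorem neg_pow_card_field (hF : Fintype.card F = q) (x : K) : (-x) ^ q = -x ^ q := by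
  subst hF; exact map_neg (FiniteField.frobeniusAlgHom F K) x

theorem sum_pow_card_field (hF : Fintype.card F = q) {ι : Type*} (s : Finset ι) (f : ι → K) :
    (∑ i ∈ s, f i) ^ q = ∑ i ∈ s, f i ^ q := by
  subst hF; exact map_sum (FiniteField.frobeniusAlgHom F K) f s

theorem algebraMap_pow_card_field (hF : Fintype.card F = q) (x : F) :
    algebraMap F K x ^ q = algebraMap F K x := by
  rw [← map_pow, ← hF, FiniteField.pow_card]

variable [Fintype K]

theorem pow_card_pow_card (hK : Fintype.card K = q ^ 2) (x : K) : (x ^ q) ^ q = x := by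
  rw [← pow_mul, ← sq, ← hK, FiniteField.pow_card]

/-- Coordinates on the quadratic extension in which the alternating form `x y^q - x^q y` is,
up to a constant factor, the standard symplectic form. -/
theorem exists_symplectic_coordinates (hF : Fintype.card F = q) (hK : Fintype.card K = q ^ 2) :
    ∃ κ : K ≃+ F × F, ∃ D : K, D ≠ 0 ∧ ∀ x y : K, x * y ^ q - x ^ q * y =
      algebraMap F K ((κ x).1 * (κ y).2 - (κ x).2 * (κ y).1) * D := by
  obtain ⟨θ, hθ⟩ := exists_pow_card_ne (hF ▸ Fintype.one_lt_card) hK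
  let f : F × F →+ K :=
    { toFun := fun a => algebraMap F K a.1 + algebraMap F K a.2 * θ
      map_zero' := by simp
      map_add' := fun a b => by simp only [Prod.fst_add, Prod.snd_add, map_add]; ring }
  have hf : Function.Injective f := by
    rw [injective_iff_map_eq_zero]
    rintro ⟨a, b⟩ h
    replace h : algebraMap F K a + algebraMap F K b * θ = 0 := h
    have hb : b = 0 := by
      by_contra hb
      have hb' : algebraMap F K b ≠ 0 := (map_ne_zero _).mpr hb
      apply hθ
      have : θ = algebraMap F K (-a / b) := by
        rw [map_div₀, map_neg, eq_div_iff hb']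
        linear_combination h
      rw [this, algebraMap_pow_card_field F hF]
    subst hb
    simpa using h
  have hbij : Function.Bijective f := (Fintype.bijective_iff_injective_and_card f).mpr
    ⟨hf, by rw [Fintype.card_prod, hF, hK, sq]⟩
  let κ := (AddEquiv.ofBijective f hbij).symm
  have hκ : ∀ x, x = algebraMap F K (κ x).1 + algebraMap F K (κ x).2 * θ := fun x =>
    ((AddEquiv.ofBijective f hbij).apply_symm_apply x).symm
  refine ⟨κ, θ ^ q - θ, sub_ne_zero.mpr hθ, fun x y => ?_⟩
  have hpow : ∀ x, x ^ q = algebraMap F K (κ x).1 + algebraMap F K (κ x).2 * θ ^ q := fun x => by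
    conv_lhs => rw [hκ x]
    rw [add_pow_card_field F hF, mul_pow, algebraMap_pow_card_field F hF,
      algebraMap_pow_card_field F hF]
  rw [hpow x, hpow y]
  simp only [map_sub, map_mul]
  linear_combination (algebraMap F K (κ y).1 + algebraMap F K (κ y).2 * θ ^ q) * hκ x
    - (algebraMap F K (κ x).1 + algebraMap F K (κ x).2 * θ ^ q) * hκ y

/-- A linear MDS code over the quadratic extension, given by a generator matrix, which is
contained in its Hermitian dual gives a quantum MDS code. -/
theorem existsQuantumMDSCode_of_generator (hF : Fintype.card F = q)
    (hK : Fintype.card K = q ^ 2) (hk : 1 ≤ k) (hkn : k ≤ n) (G : Matrix (Fin k) (Fin n) K)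
    (hG : ∀ i j, ∑ l, G i l * G j l ^ q = 0)
    (hdet : ∀ t : Fin k → Fin n, StrictMono t → (G.submatrix id t).det ≠ 0) :
    ExistsQuantumMDSCode q n (n - 2 * k) (k + 1) := by
  classical
  obtain ⟨κ, D, hD, hκ⟩ := exists_symplectic_coordinates F hF hK
  let ε : (Fin n → K) → (Fin n → F) × (Fin n → F) := fun x =>
    (fun l => (κ (x l)).1, fun l => (κ (x l)).2)
  have hε : Function.Injective ε := fun x y h => funext fun l =>
    κ.injective (Prod.ext (congrFun (congrArg Prod.fst h) l) (congrFun (congrArg Prod.snd h) l))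
  have hsymp : ∀ x y : Fin n → K, ∑ l, x l * y l ^ q = 0 →
      (ε x).2 ⬝ᵥ (ε y).1 = (ε y).2 ⬝ᵥ (ε x).1 := by
    intro x y h
    have h' : ∑ l, x l ^ q * y l = 0 := by
      have := congrArg (· ^ q) h
      simp only [sum_pow_card_field F hF, mul_pow, pow_card_pow_card hK] at this
      rw [this, zero_pow (by have := Fintype.card_pos (α := F); omega)]
    have h1 : algebraMap F K (∑ l, ((κ (x l)).1 * (κ (y l)).2 - (κ (x l)).2 * (κ (y l)).1)) * D
        = 0 := by
      rw [map_sum, Finset.sum_mul]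
      simp_rw [← hκ]
      rw [Finset.sum_sub_distrib, h, h', sub_zero]
    have h2 := (map_eq_zero _).mp ((mul_eq_zero.mp h1).resolve_right hD)
    rw [Finset.sum_sub_distrib, sub_eq_zero] at h2
    simp only [ε, dotProduct]
    rw [← h2]
    exact Finset.sum_congr rfl fun l _ => mul_comm _ _
  let γ : (Fin k → K) →+ (Fin n → F) × (Fin n → F) :=
    { toFun := fun c => ε (c ᵥ* G)
      map_zero' := by ext <;> simp [ε]
      map_add' := fun c d => by ext <;> simp [ε, Matrix.add_vecMul] }
  have horth : ∀ c : Fin k → K, ∀ y : Fin n → K, (∀ i, ∑ l, G i l * y l ^ q = 0) →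
      ∑ l, (c ᵥ* G) l * y l ^ q = 0 := by
    intro c y hy
    simp only [Matrix.vecMul, dotProduct, Finset.sum_mul]
    rw [Finset.sum_comm]
    refine Finset.sum_eq_zero fun i _ => ?_
    simp only [mul_assoc, ← Finset.mul_sum, hy, mul_zero]
  have hself : ∀ c d : Fin k → K, ∑ l, (c ᵥ* G) l * (d ᵥ* G) l ^ q = 0 := by
    intro c d
    refine horth c _ fun i => ?_
    simp only [Matrix.vecMul, dotProduct, sum_pow_card_field F hF, Finset.mul_sum]
    rw [Finset.sum_comm]
    refine Finset.sum_eq_zero fun j _ => ?_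
    have h := congrArg (d j ^ q * ·) (hG i j)
    simp only [Finset.mul_sum, mul_zero] at h
    rw [← h]
    exact Finset.sum_congr rfl fun l _ => by ring
  -- a codeword that vanishes on `k` coordinates is zero
  have hmds : ∀ S : Finset (Fin n), k ≤ S.card → ∀ c : Fin k → K,
      (∀ i ∈ S, (c ᵥ* G) i = 0) → c = 0 := by
    intro S hS c hc
    obtain ⟨T, hTS, hT⟩ := Finset.exists_subset_card_eq hS
    refine Matrix.eq_zero_of_vecMul_eq_zero (hdet _ (T.orderEmbOfFin hT).strictMono) ?_
    ext j
    exact hc _ (hTS (T.orderEmbOfFin_mem hT j))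
  refine existsQuantumMDSCode_of_stabilizer hF (Γ := Fin k → K) ?_ γ ?_ ?_ ?_ ?_
  · rw [Fintype.card_fun, hK, Fintype.card_fin, ← pow_mul]
  · rw [injective_iff_map_eq_zero]
    intro c hc
    refine hmds Finset.univ (by simpa using hkn) c fun i _ => ?_
    exact congrFun (hε (a₂ := 0) (by simpa [γ, ε, Prod.ext_iff, funext_iff] using hc)) i
  · exact fun c d => hsymp _ _ (hself c d)
  · intro S hS a b
    obtain ⟨T, hST, -, hT⟩ := Finset.exists_subsuperset_card_eq (Finset.subset_univ S) hS
      (by simpa using hkn)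
    let t := T.orderEmbOfFin hT
    let x : Fin n → K := fun l => if h : l ∈ S then κ.symm (a ⟨l, h⟩, b ⟨l, h⟩) else 0
    refine ⟨(x ∘ t) ᵥ* (G.submatrix id t)⁻¹, fun i => ?_⟩
    have h1 : ((x ∘ t) ᵥ* (G.submatrix id t)⁻¹) ᵥ* (G.submatrix id t) = x ∘ t := by
      rw [Matrix.vecMul_vecMul, Matrix.nonsing_inv_mul _
        (isUnit_iff_ne_zero.mpr (hdet _ t.strictMono)), Matrix.vecMul_one]
    obtain ⟨j, hj⟩ : ∃ j, t j = i := by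
      have : (i : Fin n) ∈ Set.range t := by
        rw [Finset.range_orderEmbOfFin]; exact hST i.2
      exact this
    have h2 : (((x ∘ t) ᵥ* (G.submatrix id t)⁻¹) ᵥ* G) i = κ.symm (a i, b i) := by
      rw [← hj]
      refine (congrFun h1 j).trans ?_
      simp [x, hj]
    have h3 : γ ((x ∘ t) ᵥ* (G.submatrix id t)⁻¹) =
      ε (((x ∘ t) ᵥ* (G.submatrix id t)⁻¹) ᵥ* G) := rfl
    simp only [h3, ε, h2, AddEquiv.apply_symm_apply, and_self]
  · intro h2k
    obtain ⟨S, -, hS⟩ := Finset.exists_subset_card_eq (s := (Finset.univ : Finset (Fin n)))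
      (n := k + 1) (by simp; omega)
    -- `k` linear conditions on `k + 1` coordinates have a non-trivial solution
    obtain ⟨y, hy, hy0⟩ := Submodule.exists_mem_ne_zero_of_ne_bot
      (LinearMap.ker_ne_bot_of_finrank_lt
        (f := Matrix.mulVecLin (G.submatrix id (fun l : S => (l : Fin n)))) (by simp [hS]))
    let u : Fin n → K := fun l => if h : l ∈ S then y ⟨l, h⟩ ^ q else 0
    have hu : ∀ i, ∑ l, G i l * u l ^ q = 0 := by
      intro i
      have hq0 : q ≠ 0 := by have := Fintype.card_pos (α := F); omega
      rw [← Finset.sum_subset (Finset.subset_univ S) (fun l _ hl => by simp [u, hl, hq0]),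
        ← Finset.sum_coe_sort]
      have h := congrFun (LinearMap.mem_ker.mp hy) i
      refine Eq.trans (Finset.sum_congr rfl fun l _ => ?_) h
      simp [u, pow_card_pow_card hK]
    have hu0 : u ≠ 0 := by
      obtain ⟨l, hl⟩ := Function.ne_iff.mp hy0
      refine Function.ne_iff.mpr ⟨l, ?_⟩
      simpa [u] using fun h : y l = 0 => absurd h hl
    refine ⟨S, hS, ε u, fun h => hu0 (hε (a₂ := 0) ?_), fun i hi => by simp [ε, u, hi],
      fun c => hsymp _ _ (horth c u hu), ?_⟩
    · rw [h]; ext <;> simp [ε]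
    · rintro ⟨c, hc⟩
      by_contra! hlt
      have hc' : c ᵥ* G = u := hε hc
      refine hu0 ?_
      have h0 : c = 0 := by
        refine hmds Sᶜ (by rw [Finset.card_compl, hS, Fintype.card_fin]; omega) c fun i hi => ?_
        rw [hc']
        simp [u, Finset.mem_compl.mp hi]
      rw [← hc', h0, Matrix.zero_vecMul]

end Hermitian

/-! ### Generalised Reed–Solomon codes -/

section ReedSolomon

/-- Surjectivity of the norm to the subfield with `q` elements. -/
theorem exists_pow_succ_eq {K : Type*} [Field K] [Fintype K] {q : ℕ} (hq : 1 < q)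
    (hK : Fintype.card K = q ^ 2) {w : K} (hw0 : w ≠ 0) (hw : w ^ q = w) :
    ∃ v : K, v ≠ 0 ∧ v ^ (q + 1) = w := by
  classical
  obtain ⟨g, hg⟩ := IsCyclic.exists_generator (α := Kˣ)
  have hord : orderOf g = (q + 1) * (q - 1) := by
    rw [orderOf_eq_card_of_forall_mem_zpowers hg, Nat.card_eq_fintype_card, Fintype.card_units, hK,
      ← Nat.sq_sub_sq, one_pow]
  obtain ⟨j, hj⟩ := (mem_powers_iff_mem_zpowers.mpr (hg (Units.mk0 w hw0)))
  have h1 : (Units.mk0 w hw0) ^ (q - 1) = 1 := by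
    have h2 : w ^ (q - 1) * w = 1 * w := by
      rw [← pow_succ, Nat.sub_add_cancel hq.le, hw, one_mul]
    exact Units.ext (mul_right_cancel₀ hw0 h2)
  simp only at hj
  rw [← hj, ← pow_mul, ← orderOf_dvd_iff_pow_eq_one, hord] at h1
  obtain ⟨i, rfl⟩ := Nat.dvd_of_mul_dvd_mul_right (by omega) h1
  refine ⟨(g ^ i : Kˣ), Units.ne_zero _, ?_⟩
  have h3 := congrArg Units.val hj
  rw [Units.val_mk0] at h3
  rw [← h3, mul_comm (q + 1) i, pow_mul, Units.val_pow_eq_pow_val (g ^ i)]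

variable (F : Type*) {K : Type*} [Field F] [Fintype F] [Field K] [Algebra F K] [Fintype K]
  {q n k : ℕ}

/-- Points of the projective line, in homogeneous coordinates `(α l : β l)`, with weights in the
subfield for which all the Hermitian products of monomials vanish, give a quantum MDS code. -/
theorem existsQuantumMDSCode_of_points (hF : Fintype.card F = q) (hK : Fintype.card K = q ^ 2)
    (hk : 1 ≤ k) (hkn : k ≤ n) {ι : Type*} [Fintype ι] (hι : Fintype.card ι = n)
    (α β w : ι → K) (hne : ∀ l m, l ≠ m → α l * β m ≠ α m * β l)
    (hw : ∀ l, w l ≠ 0 ∧ w l ^ q = w l)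
    (hsum : ∀ i j : Fin k, ∑ l, w l * (α l ^ (i : ℕ) * β l ^ (i.rev : ℕ)) *
      (α l ^ (j : ℕ) * β l ^ (j.rev : ℕ)) ^ q = 0) :
    ExistsQuantumMDSCode q n (n - 2 * k) (k + 1) := by
  choose v hv0 hv using fun l =>
    exists_pow_succ_eq (hF ▸ Fintype.one_lt_card) hK (hw l).1 (hw l).2
  let σ : Fin n ≃ ι := (Fintype.equivFinOfCardEq hι).symm
  let G : Matrix (Fin k) (Fin n) K :=
    Matrix.of fun i l => v (σ l) * (α (σ l) ^ (i : ℕ) * β (σ l) ^ (i.rev : ℕ))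
  refine existsQuantumMDSCode_of_generator F hF hK hk hkn G (fun i j => ?_) fun t ht => ?_
  · rw [← hsum i j]
    refine Fintype.sum_equiv σ _ _ fun l => ?_
    rw [← hv (σ l)]
    simp only [G, Matrix.of_apply, mul_pow]
    ring
  · have h1 : G.submatrix id t = (Matrix.projVandermonde (fun j => α (σ (t j)))
        (fun j => β (σ (t j))))ᵀ * Matrix.diagonal (fun j => v (σ (t j))) := by
      ext i j
      simp only [G, Matrix.submatrix_apply, Matrix.of_apply, Matrix.mul_diagonal,
        Matrix.transpose_apply, Matrix.projVandermonde_apply, id]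
      ring
    rw [h1, Matrix.det_mul, Matrix.det_transpose, Matrix.det_diagonal, Matrix.det_projVandermonde]
    refine mul_ne_zero (Finset.prod_ne_zero_iff.mpr fun i _ => Finset.prod_ne_zero_iff.mpr
      fun j hj => sub_ne_zero.mpr ?_) (Finset.prod_ne_zero_iff.mpr fun j _ => hv0 _)
    exact hne _ _ fun h => (Finset.mem_Ioi.mp hj).ne' (ht.injective (σ.injective h))

/-- The `m`-th moment of the weights `w` on the points of `X`. -/
def moment (X : Finset K) (w : K → K) (m : ℕ) : K := ∑ a ∈ X, w a * a ^ m

theorem moment_pow (hF : Fintype.card F = q) (hK : Fintype.card K = q ^ 2) {X : Finset K}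
    {w : K → K} (hw : ∀ a ∈ X, w a ≠ 0 ∧ w a ^ q = w a) (i j : ℕ) :
    moment X w (i + q * j) ^ q = moment X w (j + q * i) := by
  rw [moment, sum_pow_card_field F hF]
  refine Finset.sum_congr rfl fun a ha => ?_
  have h : (a ^ (i + q * j)) ^ q = ((a ^ j) ^ q) ^ q * a ^ (q * i) := by ring
  rw [mul_pow, (hw a ha).2, h, pow_card_pow_card hK, ← pow_add]

/-- The Hermitian products of the monomials `x^i` and `x^j` are the moments `i + q j`, which by
conjugation is needed for `j ≤ i` only. If the product of `x^(k-1)` with itself is the only one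
that does not vanish, then the point at infinity is added with a weight that cancels it. -/
theorem existsQuantumMDSCode_of_moments (hF : Fintype.card F = q) (hK : Fintype.card K = q ^ 2)
    (hk : 1 ≤ k) {X : Finset K} (hX : X.card = n) (hkn : k ≤ n) {w : K → K}
    (hw : ∀ a ∈ X, w a ≠ 0 ∧ w a ^ q = w a)
    (hoff : ∀ i j, j < i → i < k → moment X w (i + q * j) = 0)
    (hdiag : ∀ i, i + 1 < k → moment X w (i + q * i) = 0) :
    (moment X w (k - 1 + q * (k - 1)) = 0 → ExistsQuantumMDSCode q n (n - 2 * k) (k + 1)) ∧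
    (moment X w (k - 1 + q * (k - 1)) ≠ 0 →
      ExistsQuantumMDSCode q (n + 1) (n + 1 - 2 * k) (k + 1)) := by
  have hq : 1 < q := hF ▸ Fintype.one_lt_card
  have hall : ∀ i j, i < k → j < k → ¬ (i = k - 1 ∧ j = k - 1) → moment X w (i + q * j) = 0 := by
    intro i j hi hj hij
    rcases lt_trichotomy j i with h | rfl | h
    · exact hoff i j h hi
    · exact hdiag j (by omega)
    · rw [← moment_pow F hF hK hw, hoff j i h hj, zero_pow (by omega)]
  have hsum : ∀ i j, ∑ l : X, w l * ((l : K) ^ i * 1) * ((l : K) ^ j * 1) ^ q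
      = moment X w (i + q * j) := by
    intro i j
    refine (Finset.sum_coe_sort X fun a => w a * (a ^ i * 1) * (a ^ j * 1) ^ q).trans
      (Finset.sum_congr rfl fun l _ => ?_)
    rw [pow_add, mul_comm q j, pow_mul, mul_one, mul_one, mul_assoc]
  refine ⟨fun hs => ?_, fun hs => ?_⟩
  · refine existsQuantumMDSCode_of_points F hF hK hk hkn (ι := X) (by simpa using hX)
      (fun l => l) (fun _ => 1) (fun l => w l)
      (fun l m hlm h => hlm (Subtype.ext (by simpa using h)))
      (fun l => hw l l.2) fun i j => ?_
    simp only [one_pow]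
    rw [hsum]
    by_cases hij : (i : ℕ) = k - 1 ∧ (j : ℕ) = k - 1
    · rw [hij.1, hij.2, hs]
    · exact hall i j i.2 j.2 hij
  · refine existsQuantumMDSCode_of_points F hF hK hk (hkn.trans n.le_succ) (ι := Option X)
      (by simp [hX]) (fun l => l.elim 1 (fun a => a)) (fun l => l.elim 0 (fun _ => 1))
      (fun l => l.elim (-moment X w (k - 1 + q * (k - 1))) (fun a => w a)) ?_ ?_ fun i j => ?_
    · rintro (_ | l) (_ | m) hlm
      · exact absurd rfl hlm
      · simp
      · simp
      · intro h
        simp only [Option.elim_some, mul_one] at h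
        exact hlm (congrArg some (Subtype.ext h))
    · rintro (_ | l)
      · refine ⟨neg_ne_zero.mpr hs, ?_⟩
        change (-_) ^ q = -_
        rw [neg_pow_card_field F hF, moment_pow F hF hK hw]
      · exact hw l l.2
    · rw [Fintype.sum_option]
      simp only [Option.elim_none, Option.elim_some, one_pow, one_mul]
      rw [hsum]
      by_cases hij : (i : ℕ) = k - 1 ∧ (j : ℕ) = k - 1
      · have hi : (i.rev : ℕ) = 0 := by rw [Fin.val_rev]; omega
        have hj : (j.rev : ℕ) = 0 := by rw [Fin.val_rev]; omega
        rw [hi, hj, hij.1, hij.2, pow_zero, one_pow]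
        ring
      · have h0 : (0 : K) ^ (i.rev : ℕ) * ((0 : K) ^ (j.rev : ℕ)) ^ q = 0 := by
          rw [← pow_mul, ← pow_add]
          refine zero_pow fun h => hij ?_
          have h1 := i.2
          have h2 := j.2
          rw [Fin.val_rev, Fin.val_rev] at h
          obtain ⟨h3, h4⟩ := Nat.add_eq_zero_iff.mp h
          rcases Nat.mul_eq_zero.mp h4 with h5 | h5 <;> constructor <;> omega
        rw [hall i j i.2 j.2 hij, mul_assoc, h0, mul_zero, zero_add]

end ReedSolomon

/-! ### Lengths with Lagrange weights in the subfield -/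

section GoodLength

variable {K : Type*} [Field K] {q n : ℕ}

/-- There are `N` points in `K`, with non-zero weights in the subfield with `q` elements, for
which the first non-vanishing moment is the one of order `N - 1`. -/
def IsLagrangeLength (K : Type*) [Field K] (q N : ℕ) : Prop :=
  ∃ (X : Finset K) (w : K → K), X.card = N ∧ (∀ a ∈ X, w a ≠ 0 ∧ w a ^ q = w a) ∧
    (∀ m, m + 2 ≤ N → moment X w m = 0) ∧ moment X w (N - 1) ≠ 0

/-- By Lagrange interpolation the weights `1 / f' a` on the roots of `f` have vanishing moments
of order less than `N - 1`. They may be multiplied by a common factor. -/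
theorem isLagrangeLength_of_polynomial {f : Polynomial K} (hf : f.Monic) {X : Finset K}
    (hX : X.Nonempty) (hdeg : f.natDegree = X.card) (hroot : ∀ a ∈ X, f.eval a = 0)
    {s : K} (hs : s ≠ 0)
    (hq : ∀ a ∈ X, (s * f.derivative.eval a) ^ q = s * f.derivative.eval a) :
    IsLagrangeLength K q X.card := by
  classical
  have hfX : f = Lagrange.nodal X id := by
    refine Polynomial.eq_of_degree_le_of_eval_finset_eq X ?_ ?_ ?_ fun a ha => ?_
    · rw [Polynomial.degree_eq_natDegree hf.ne_zero, hdeg]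
    · rw [Polynomial.degree_eq_natDegree hf.ne_zero, hdeg, Lagrange.degree_nodal]
    · rw [hf.leadingCoeff, Lagrange.nodal_monic.leadingCoeff]
    · rw [hroot a ha]; exact (Lagrange.eval_nodal_at_node (v := id) ha).symm
  have hder : ∀ a ∈ X, f.derivative.eval a = ∏ b ∈ X.erase a, (a - b) := by
    intro a ha
    rw [hfX]
    have := Lagrange.eval_nodal_derivative_eval_node_eq (v := id) ha
    rw [Lagrange.eval_nodal] at this
    exact this
  have hder0 : ∀ a ∈ X, f.derivative.eval a ≠ 0 := by
    intro a ha
    rw [hder a ha]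
    exact Finset.prod_ne_zero_iff.mpr fun b hb =>
      sub_ne_zero.mpr (Finset.ne_of_mem_erase hb).symm
  have hmom : ∀ m, m < X.card →
      moment X (fun a => (s * f.derivative.eval a)⁻¹) m
        = s⁻¹ * (Polynomial.X ^ m : Polynomial K).coeff (X.card - 1) := by
    intro m hm
    rw [Lagrange.coeff_eq_sum (s := X) (v := id) (Function.injective_id.injOn)
      (by rw [Polynomial.degree_X_pow]; exact_mod_cast hm), moment, Finset.mul_sum]
    refine Finset.sum_congr rfl fun a ha => ?_
    rw [hder a ha, mul_inv, Polynomial.eval_pow, Polynomial.eval_X]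
    simp only [id, div_eq_mul_inv]
    ring
  have hpos := hX.card_pos
  refine ⟨X, fun a => (s * f.derivative.eval a)⁻¹, rfl, fun a ha => ⟨?_, ?_⟩, fun m hm => ?_, ?_⟩
  · exact inv_ne_zero (mul_ne_zero hs (hder0 a ha))
  · rw [inv_pow, hq a ha]
  · rw [hmom m (by omega), Polynomial.coeff_X_pow, if_neg (by omega), mul_zero]
  · rw [hmom _ (by omega), Polynomial.coeff_X_pow, if_pos rfl, mul_one]
    exact inv_ne_zero hs

section RootsOfUnity

variable [Fintype K]

theorem exists_isPrimitiveRoot_of_dvd (hn : n ∣ Fintype.card K - 1) :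
    ∃ ζ : K, IsPrimitiveRoot ζ n := by
  classical
  obtain ⟨g, hg⟩ := IsCyclic.exists_generator (α := Kˣ)
  have h1 : IsPrimitiveRoot g (Fintype.card K - 1) := by
    have := IsPrimitiveRoot.orderOf g
    rwa [orderOf_eq_card_of_forall_mem_zpowers hg, Nat.card_eq_fintype_card,
      Fintype.card_units] at this
  obtain ⟨m, hm⟩ := hn
  have hpos : 0 < Fintype.card K - 1 := Nat.sub_pos_of_lt Fintype.one_lt_card
  exact ⟨_, IsPrimitiveRoot.coe_units_iff.mpr (h1.pow hpos (by rw [hm, mul_comm]))⟩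

theorem card_filter_pow_eq [DecidableEq K] (hn : n ∣ Fintype.card K - 1) {c : K} (hc : c ≠ 0)
    (hcn : ∃ b, b ^ n = c) : (Finset.univ.filter fun a : K => a ^ n = c).card = n := by
  have hn0 : 0 < n := Nat.pos_of_dvd_of_pos hn (Nat.sub_pos_of_lt Fintype.one_lt_card)
  obtain ⟨ζ, hζ⟩ := exists_isPrimitiveRoot_of_dvd hn
  have h1 : (Finset.univ.filter fun a : K => a ^ n = c) =
      (Polynomial.nthRoots n c).toFinset := by
    ext a
    simp [Polynomial.mem_nthRoots hn0]
  rw [h1, Multiset.toFinset_card_of_nodup (hζ.nthRoots_nodup hc), hζ.card_nthRoots, if_pos hcn]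

theorem exists_pow_eq_of_pow_eq_one {m : ℕ} (hnm : n * m = Fintype.card K - 1) {c : K}
    (hc : c ^ m = 1) : ∃ b, b ^ n = c := by
  have hpos : 0 < Fintype.card K - 1 := Nat.sub_pos_of_lt Fintype.one_lt_card
  have : NeZero (Fintype.card K - 1) := ⟨hpos.ne'⟩
  obtain ⟨ζ, hζ⟩ := exists_isPrimitiveRoot_of_dvd (K := K) dvd_rfl
  obtain ⟨i, -, hi⟩ := hζ.eq_pow_of_pow_eq_one (ξ := c)
    (by rw [← hnm, mul_comm, pow_mul, hc, one_pow])
  rw [← hi, ← pow_mul, hζ.pow_eq_one_iff_dvd, ← hnm] at hc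
  obtain ⟨j, rfl⟩ := Nat.dvd_of_mul_dvd_mul_right (Nat.pos_of_ne_zero fun h => by
    rw [h, mul_zero] at hnm; omega) hc
  exact ⟨ζ ^ j, by rw [← pow_mul, mul_comm, hi]⟩

end RootsOfUnity

variable (F : Type*) [Field F] [Fintype F] [Algebra F K] [Fintype K]

/-- Zero together with the `n`-th roots of the elements of a subset `T` of the subfield: these
are the roots of `X ∏ (X ^ n - c)`, whose derivative takes values in the subfield there. -/
theorem isLagrangeLength_of_roots (hF : Fintype.card F = q) (hn : n ∣ Fintype.card K - 1)
    {T : Finset K} (hT : ∀ c ∈ T, c ≠ 0 ∧ c ^ q = c ∧ ∃ b, b ^ n = c) :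
    IsLagrangeLength K q (T.card * n + 1) := by
  classical
  have hn0 : 0 < n := Nat.pos_of_dvd_of_pos hn (Nat.sub_pos_of_lt Fintype.one_lt_card)
  let g : Polynomial K := Lagrange.nodal T id
  let f : Polynomial K := Polynomial.X * g.comp (Polynomial.X ^ n)
  let X : Finset K := insert 0 (Finset.univ.filter fun a : K => a ^ n ∈ T)
  have h0 : (0 : K) ∉ Finset.univ.filter fun a : K => a ^ n ∈ T := by
    simp only [Finset.mem_filter, Finset.mem_univ, true_and, zero_pow hn0.ne']
    exact fun h => (hT 0 h).1 rfl
  have hcard : X.card = T.card * n + 1 := by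
    rw [Finset.card_insert_of_notMem h0, ← Finset.sum_card_fiberwise_eq_card_filter,
      Finset.sum_const_nat fun c hc => card_filter_pow_eq hn (hT c hc).1 (hT c hc).2.2]
  have hgm : g.Monic := Lagrange.nodal_monic
  have hgc : (g.comp (Polynomial.X ^ n)).Monic :=
    hgm.comp (Polynomial.monic_X_pow n) (by rw [Polynomial.natDegree_X_pow]; exact hn0.ne')
  have hfm : f.Monic := Polynomial.monic_X.mul hgc
  have hdeg : f.natDegree = X.card := by
    rw [hcard, Polynomial.monic_X.natDegree_mul hgc, Polynomial.natDegree_comp,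
      Polynomial.natDegree_X_pow, Lagrange.natDegree_nodal, Polynomial.natDegree_X, add_comm]
  have hsub : ∀ x y : K, x ^ q = x → y ^ q = y → (x - y) ^ q = x - y := fun x y hx hy => by
    rw [sub_pow_card_field F hF, hx, hy]
  have hg0 : ∀ c ∈ T, g.eval c = 0 := fun c hc => Lagrange.eval_nodal_at_node (v := id) hc
  have hq0 : q ≠ 0 := by have := Fintype.card_pos (α := F); omega
  have hdf : ∀ a, f.derivative.eval a = g.eval (a ^ n)
      + a * (g.derivative.eval (a ^ n) * (n * a ^ (n - 1))) := fun a => by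
    simp only [f, Polynomial.derivative_mul, Polynomial.derivative_comp, Polynomial.derivative_X,
      Polynomial.derivative_X_pow, Polynomial.eval_add, Polynomial.eval_mul, Polynomial.eval_comp,
      Polynomial.eval_pow, Polynomial.eval_X, Polynomial.eval_one, Polynomial.eval_C]
    ring
  rw [← hcard]
  refine isLagrangeLength_of_polynomial hfm ⟨0, Finset.mem_insert_self _ _⟩ hdeg (fun a ha => ?_)
    one_ne_zero fun a ha => ?_
  · rcases Finset.mem_insert.mp ha with rfl | ha
    · simp [f]
    · simp [f, hg0 _ (Finset.mem_filter.mp ha).2]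
  · rw [one_mul, hdf]
    rcases Finset.mem_insert.mp ha with rfl | ha
    · rw [zero_mul, add_zero, zero_pow hn0.ne', Lagrange.eval_nodal, ← Finset.prod_pow]
      exact Finset.prod_congr rfl fun c hc => hsub _ _ (zero_pow hq0) (hT c hc).2.1
    · have hc := (Finset.mem_filter.mp ha).2
      have h1 : a * (g.derivative.eval (a ^ n) * (n * a ^ (n - 1)))
          = g.derivative.eval (a ^ n) * n * a ^ n := by
        rw [← mul_pow_sub_one hn0.ne' a]; ring
      have h2 : g.derivative.eval (a ^ n) = _ :=
        Lagrange.eval_nodal_derivative_eval_node_eq (v := id) hc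
      have h3 : (n : K) ^ q = n := by
        rw [← map_natCast (algebraMap F K), algebraMap_pow_card_field F hF]
      rw [hg0 _ hc, zero_add, h1, h2, Lagrange.eval_nodal, mul_pow, mul_pow, h3, (hT _ hc).2.1,
        ← Finset.prod_pow]
      congr 2
      exact Finset.prod_congr rfl fun c hc' =>
        hsub _ _ (hT _ hc).2.1 (hT c (Finset.mem_of_mem_erase hc')).2.1

/-- A union of `t` additive cosets of the subfield: these are the roots of `∏ (X ^ q - X - c)`,
where `c` ranges over elements of trace zero. -/
theorem isLagrangeLength_of_cosets (hF : Fintype.card F = q) (hK : Fintype.card K = q ^ 2)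
    {t : ℕ} (ht : 1 ≤ t) (htq : t ≤ q) : IsLagrangeLength K q (t * q) := by
  classical
  have hq : 1 < q := hF ▸ Fintype.one_lt_card
  let L : Finset K := Finset.univ.image fun x : K => x ^ q - x
  have hfib : ∀ c ∈ L, (Finset.univ.filter fun x : K => x ^ q - x = c).card = q := by
    intro c hc
    obtain ⟨b, -, rfl⟩ := Finset.mem_image.mp hc
    refine le_antisymm ?_ ?_
    · have hdeg : (Polynomial.X ^ q - Polynomial.X - Polynomial.C (b ^ q - b)
          : Polynomial K).natDegree = q := by
        rw [Polynomial.natDegree_sub_C, FiniteField.X_pow_card_sub_X_natDegree_eq K hq]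
      conv_rhs => rw [← hdeg]
      refine Polynomial.card_le_degree_of_subset_roots fun x hx => ?_
      rw [Polynomial.mem_roots (fun h => by rw [h, Polynomial.natDegree_zero] at hdeg; omega)]
      simpa [sub_eq_zero] using hx
    · rw [← hF, ← Finset.card_univ]
      refine Finset.card_le_card_of_injOn (fun y : F => b + algebraMap F K y) (fun y _ => ?_)
        (fun y _ z _ h => (algebraMap F K).injective (add_left_cancel h))
      simp [hF, add_pow_card_field F hF, algebraMap_pow_card_field F hF]
  have hL : L.card = q := by
    have h := Finset.card_eq_sum_card_fiberwise (s := (Finset.univ : Finset K)) (t := L)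
      (f := fun x : K => x ^ q - x) (fun x _ => Finset.mem_image_of_mem _ (Finset.mem_univ x))
    rw [Finset.sum_const_nat hfib, Finset.card_univ, hK, sq] at h
    exact (Nat.eq_of_mul_eq_mul_right (by omega) h).symm
  have hneg : ∀ c ∈ L, c ^ q = -c := by
    intro c hc
    obtain ⟨b, -, rfl⟩ := Finset.mem_image.mp hc
    rw [sub_pow_card_field F hF, pow_card_pow_card hK, neg_sub]
  obtain ⟨δ, hδ, hδ0⟩ := Finset.exists_mem_ne (s := L) (by omega) 0
  obtain ⟨T, hTL, hT⟩ := Finset.exists_subset_card_eq (s := L) (n := t) (by omega)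
  let g : Polynomial K := Lagrange.nodal T id
  let r : Polynomial K := Polynomial.X ^ q - Polynomial.X
  let X : Finset K := Finset.univ.filter fun a : K => a ^ q - a ∈ T
  have hcard : X.card = t * q := by
    rw [← Finset.sum_card_fiberwise_eq_card_filter,
      Finset.sum_const_nat fun c hc => hfib c (hTL hc), hT]
  have hrdeg : r.natDegree = q := FiniteField.X_pow_card_sub_X_natDegree_eq K hq
  have hrm : r.Monic := Polynomial.monic_X_pow_sub (by
    rw [Polynomial.degree_X]; exact_mod_cast hq)
  have hfm : (g.comp r).Monic := Lagrange.nodal_monic.comp hrm (by omega)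
  have hdeg : (g.comp r).natDegree = X.card := by
    rw [hcard, Polynomial.natDegree_comp, hrdeg, Lagrange.natDegree_nodal, hT]
  have hreval : ∀ a, r.eval a = a ^ q - a := fun a => by simp [r]
  have hqK : (q : K) = 0 := by
    rw [← map_natCast (algebraMap F K), ← hF, FiniteField.cast_card_eq_zero, map_zero]
  have hdf : ∀ a, (g.comp r).derivative.eval a = -g.derivative.eval (a ^ q - a) := fun a => by
    simp [r, Polynomial.derivative_comp, Polynomial.derivative_X_pow, hqK]
  rw [← hcard]
  -- the derivative is a product of `t - 1` elements of trace zero, up to sign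
  refine isLagrangeLength_of_polynomial hfm
    (Finset.card_pos.mp (by rw [hcard]; exact Nat.mul_pos (by omega) (by omega))) hdeg
    (fun a ha => ?_) (s := δ ^ (t - 1)) (pow_ne_zero _ hδ0) fun a ha => ?_
  · rw [Polynomial.eval_comp, hreval]
    exact Lagrange.eval_nodal_at_node (v := id) (Finset.mem_filter.mp ha).2
  · have hc := (Finset.mem_filter.mp ha).2
    have h2 : g.derivative.eval (a ^ q - a) = _ :=
      Lagrange.eval_nodal_derivative_eval_node_eq (v := id) hc
    have h3 : (g.derivative.eval (a ^ q - a)) ^ q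
        = (-1) ^ (t - 1) * g.derivative.eval (a ^ q - a) := by
      rw [h2, Lagrange.eval_nodal, ← Finset.prod_pow, ← hT, ← Finset.card_erase_of_mem hc,
        ← Finset.prod_const, ← Finset.prod_mul_distrib]
      refine Finset.prod_congr rfl fun c hc' => ?_
      rw [id, id, sub_pow_card_field F hF, hneg _ (hTL hc),
        hneg _ (hTL (Finset.mem_of_mem_erase hc'))]
      ring
    have h4 : (δ ^ (t - 1)) ^ q = (-1) ^ (t - 1) * δ ^ (t - 1) := by
      rw [pow_right_comm, hneg _ hδ, neg_pow]
    have h5 : ((-1 : K) ^ (t - 1)) * (-1) ^ (t - 1) = 1 := by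
      rw [← mul_pow, neg_one_mul, neg_neg, one_pow]
    rw [hdf, mul_pow, neg_pow_card_field F hF, h3, h4]
    linear_combination (-(δ ^ (t - 1) * g.derivative.eval (a ^ q - a))) * h5

end GoodLength

/-! ### A quantum MDS code of length nine over an alphabet of size five -/

section SporadicCode

/-- The field with 25 elements, as the extension of `ZMod 5` by a square root of 2. -/
abbrev FieldTwentyFive : Type := QuadraticAlgebra (ZMod 5) 2 0

instance : Fact (Nat.Prime 5) := ⟨by norm_num⟩

instance : Fact (∀ r : ZMod 5, r ^ 2 ≠ 2 + 0 * r) := ⟨by decide⟩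

instance : Fintype FieldTwentyFive :=
  Fintype.ofEquiv (ZMod 5 × ZMod 5) (QuadraticAlgebra.equivProd 2 0).symm

/-- The matrix `(1 | A)`, where `A` consists of four rows of a circulant matrix of order five
whose rows are pairwise orthogonal of norm `-1` for the Hermitian form. -/
def circulantGenerator : Matrix (Fin 4) (Fin 9) FieldTwentyFive :=
  ![![1, 0, 0, 0, ⟨0, 1⟩, ⟨0, 3⟩, ⟨2, 2⟩, ⟨2, 2⟩, ⟨0, 3⟩],
    ![0, 1, 0, 0, ⟨0, 3⟩, ⟨0, 1⟩, ⟨0, 3⟩, ⟨2, 2⟩, ⟨2, 2⟩],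
    ![0, 0, 1, 0, ⟨2, 2⟩, ⟨0, 3⟩, ⟨0, 1⟩, ⟨0, 3⟩, ⟨2, 2⟩],
    ![0, 0, 0, 1, ⟨2, 2⟩, ⟨2, 2⟩, ⟨0, 3⟩, ⟨0, 1⟩, ⟨0, 3⟩]]

/-- The minor of a matrix with four rows on the columns `a`, `b`, `c`, `d`, expanded along the
rows. -/
def minorFour {R ι : Type*} [CommRing R] (M : Matrix (Fin 4) ι R) (a b c d : ι) : R :=
  M 0 a * (M 1 b * (M 2 c * M 3 d - M 2 d * M 3 c) - M 1 c * (M 2 b * M 3 d - M 2 d * M 3 b)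
    + M 1 d * (M 2 b * M 3 c - M 2 c * M 3 b))
  - M 0 b * (M 1 a * (M 2 c * M 3 d - M 2 d * M 3 c) - M 1 c * (M 2 a * M 3 d - M 2 d * M 3 a)
    + M 1 d * (M 2 a * M 3 c - M 2 c * M 3 a))
  + M 0 c * (M 1 a * (M 2 b * M 3 d - M 2 d * M 3 b) - M 1 b * (M 2 a * M 3 d - M 2 d * M 3 a)
    + M 1 d * (M 2 a * M 3 b - M 2 b * M 3 a))
  - M 0 d * (M 1 a * (M 2 b * M 3 c - M 2 c * M 3 b) - M 1 b * (M 2 a * M 3 c - M 2 c * M 3 a)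
    + M 1 c * (M 2 a * M 3 b - M 2 b * M 3 a))

theorem det_submatrix_eq_minorFour {R ι : Type*} [CommRing R] (M : Matrix (Fin 4) ι R)
    (t : Fin 4 → ι) : (M.submatrix id t).det = minorFour M (t 0) (t 1) (t 2) (t 3) := by
  rw [Matrix.det_succ_row_zero, Fin.sum_univ_four, minorFour]
  simp [Matrix.det_fin_three, Fin.succAbove, Fin.lt_def]
  ring

theorem gram_circulantGenerator (i j : Fin 4) :
    ∑ l, circulantGenerator i l * circulantGenerator j l ^ 5 = 0 := by
  decide +revert +kernel

/-- The code generated is MDS: any four columns are linearly independent. -/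
theorem minorFour_circulantGenerator_ne_zero :
    ∀ a b : Fin 9, a < b → ∀ c, b < c → ∀ d, c < d → minorFour circulantGenerator a b c d ≠ 0 := by
  decide +kernel

theorem existsQuantumMDSCode_nine : ExistsQuantumMDSCode 5 9 1 5 := by
  refine existsQuantumMDSCode_of_generator (ZMod 5) (k := 4) (ZMod.card 5)
    (K := FieldTwentyFive) ?_ (by norm_num) (by norm_num) circulantGenerator
    gram_circulantGenerator fun t ht => ?_
  · rw [Fintype.card_congr (QuadraticAlgebra.equivProd 2 0), Fintype.card_prod, ZMod.card]
    norm_num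
  · rw [det_submatrix_eq_minorFour]
    exact minorFour_circulantGenerator_ne_zero _ _ (ht (by decide)) _ (ht (by decide)) _
      (ht (by decide))

end SporadicCode

/-! ### The admissible lengths -/

section Lengths

variable (F : Type*) {K : Type*} [Field F] [Fintype F] [Field K] [Algebra F K] [Fintype K]
  {q N k : ℕ}

/-- The `n`-th powers among the `e`-th roots of unity of the subfield supply the set `T`. -/
theorem isLagrangeLength_mul_add_one (hF : Fintype.card F = q) (hK : Fintype.card K = q ^ 2)
    {n m e r : ℕ} (hnm : n * m = q ^ 2 - 1) (hem : e ∣ m) (heq : e ∣ q - 1) (hr : r ≤ e) :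
    IsLagrangeLength K q (r * n + 1) := by
  classical
  have hq : 1 < q := hF ▸ Fintype.one_lt_card
  have hq2 : q - 1 ∣ q ^ 2 - 1 := by simpa using Nat.sub_dvd_pow_sub_pow q 1 2
  obtain ⟨ζ, hζ⟩ := exists_isPrimitiveRoot_of_dvd (K := K) (n := e) (hK ▸ heq.trans hq2)
  have he : 0 < e := Nat.pos_of_dvd_of_pos heq (by omega)
  obtain ⟨T, hT, hTr⟩ := Finset.exists_subset_card_eq
    (s := Polynomial.nthRootsFinset e (1 : K)) (n := r) (by rwa [hζ.card_nthRootsFinset])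
  rw [← hTr]
  refine isLagrangeLength_of_roots F hF (hK ▸ ⟨m, hnm.symm⟩) fun c hc => ?_
  have hc1 : c ^ e = 1 := (Polynomial.mem_nthRootsFinset he 1).mp (hT hc)
  have hpow : ∀ j, e ∣ j → c ^ j = 1 := by
    rintro _ ⟨i, rfl⟩
    rw [pow_mul, hc1, one_pow]
  refine ⟨fun h => ?_, ?_, exists_pow_eq_of_pow_eq_one (hK ▸ hnm) (hpow m hem)⟩
  · rw [h, zero_pow he.ne'] at hc1
    exact zero_ne_one hc1
  · rw [← pow_sub_one_mul (by omega : q ≠ 0), hpow _ heq, one_mul]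

theorem AdmissibleLength.isLagrangeLength (hF : Fintype.card F = q)
    (hK : Fintype.card K = q ^ 2) (h : AdmissibleLength q N) : IsLagrangeLength K q N := by
  have hq : 1 < q := hF ▸ Fintype.one_lt_card
  have hq2 : q ^ 2 - 1 = (q + 1) * (q - 1) := by rw [← Nat.sq_sub_sq, one_pow]
  have hpos : 0 < q ^ 2 - 1 := by rw [hq2]; exact Nat.mul_pos (by omega) (by omega)
  rcases h with ⟨m, hm⟩ | ⟨n, t, rfl, ⟨m, hm⟩, ht, htq⟩ | ⟨t, rfl, ht, htq⟩
  · have hN : N - 1 ≠ 0 := fun h0 => by rw [h0, zero_mul] at hm; omega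
    have := isLagrangeLength_mul_add_one (K := K) F hF hK (e := 1) hm.symm (one_dvd _) (one_dvd _)
      le_rfl
    rwa [one_mul, Nat.sub_add_cancel (by omega)] at this
  · -- with `n = g n₂` and `q + 1 = g r`, both `m = r e` and `n₂ e = q - 1` hold
    have hn : 0 < n := Nat.pos_of_ne_zero fun h0 => by rw [h0, zero_mul] at hm; omega
    have hg : 0 < n.gcd (q + 1) := Nat.gcd_pos_of_pos_left _ hn
    obtain ⟨g, n₂, r, hg0, hcop, hn₂, hr⟩ := Nat.exists_coprime' (m := n) (n := q + 1) hg
    have hgcd : n.gcd (q + 1) = g := by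
      rw [hn₂, hr, Nat.gcd_mul_right, hcop.gcd_eq_one, one_mul]
    have hdiv : n / n.gcd (q + 1) = n₂ := by
      rw [hgcd]; conv_lhs => rw [hn₂]
      exact Nat.mul_div_cancel _ hg0
    have hn₂0 : 0 < n₂ := Nat.pos_of_ne_zero fun h0 => by rw [h0, zero_mul] at hn₂; omega
    have h1 : n₂ * m = r * (q - 1) := by
      refine Nat.eq_of_mul_eq_mul_left hg0 ?_
      calc g * (n₂ * m) = n * m := by rw [hn₂]; ring
        _ = (q + 1) * (q - 1) := by rw [← hm, hq2]
        _ = g * (r * (q - 1)) := by rw [hr]; ring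
    obtain ⟨e, rfl⟩ : r ∣ m := hcop.symm.dvd_of_dvd_mul_left ⟨_, h1⟩
    have hr0 : 0 < r := Nat.pos_of_ne_zero fun h0 => by rw [h0, zero_mul] at hr; omega
    have h2 : n₂ * e = q - 1 := Nat.eq_of_mul_eq_mul_left hr0 (by rw [← h1]; ring)
    refine isLagrangeLength_mul_add_one F hF hK hm.symm (Dvd.intro_left r rfl)
      (Dvd.intro_left n₂ h2) ?_
    rw [hdiv, le_sub_iff_add_le, le_div_iff₀ (by exact_mod_cast hn₂0), le_sub_iff_add_le] at htq
    have h3 : (t + 1) * n₂ + 1 ≤ q := by exact_mod_cast htq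
    refine Nat.le_of_mul_le_mul_left ?_ hn₂0
    rw [h2, mul_comm]
    omega
  · exact isLagrangeLength_of_cosets F hF hK ht htq

/-- The moments occurring for dimension `k` have order at most `N - 2`. For dimension `k + 1`
the same is true up to conjugation, except for the product of `x^k` with itself. -/
theorem IsLagrangeLength.existsQuantumMDSCode (hF : Fintype.card F = q)
    (hK : Fintype.card K = q ^ 2) (h : IsLagrangeLength K q N) (hk : 1 ≤ k)
    (hkN : k * (q + 1) ≤ N + q - 1) :
    ExistsQuantumMDSCode q N (N - 2 * k) (k + 1) ∧
    (k * (q + 1) = N - 1 → ExistsQuantumMDSCode q (N + 1) (N - 2 * k - 1) (k + 2)) ∧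
    (k * (q + 1) ≠ N - 1 + q → k * (q + 1) ≠ N - 1 →
      ∃ N' : ℕ, (N' = N ∨ N' = N + 1) ∧
        ExistsQuantumMDSCode q N' (N' - 2 * k - 2) (k + 2)) := by
  have hq : 1 < q := hF ▸ Fintype.one_lt_card
  obtain ⟨X, w, hX, hw, hmom, htop⟩ := h
  obtain ⟨k, rfl⟩ := Nat.exists_eq_add_of_le' hk
  have hexp : (k + 1) * (q + 1) = q * k + k + q + 1 := by ring
  rw [hexp] at hkN
  have hmono : ∀ j, j ≤ k → q * j ≤ q * k := fun j hj => Nat.mul_le_mul_left q hj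
  have hkq : k ≤ q * k := Nat.le_mul_of_pos_left k (by omega)
  have hdim : k + 1 ≤ N := by omega
  refine ⟨?_, fun heq => ?_, fun h1 h2 => ?_⟩
  · refine (existsQuantumMDSCode_of_moments F hF hK hk hX hdim hw (fun i j hji hi => hmom _ ?_)
      fun i hi => hmom _ ?_).1 (hmom _ ?_)
    · have := hmono j (by omega); omega
    · have := hmono i (by omega); omega
    · simp only [Nat.add_sub_cancel]; omega
  · have h3 : 1 ≤ k + 2 := by omega
    rw [hexp] at heq
    have hmul : q * (k + 1) = q * k + q := by ring
    have := (existsQuantumMDSCode_of_moments F hF hK h3 hX (by omega) hw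
      (fun i j hji hi => hmom _ (by have := hmono j (by omega); omega))
      fun i hi => hmom _ (by have := hmono i (by omega); omega)).2
    have h4 := this (by
      have h5 : k + 2 - 1 + q * (k + 2 - 1) = N - 1 := by
        rw [show k + 2 - 1 = k + 1 by omega, hmul]; omega
      rw [h5]; exact htop)
    convert h4 using 1
    omega
  · rw [hexp] at h1 h2
    have h3 : 1 ≤ k + 2 := by omega
    have := existsQuantumMDSCode_of_moments F hF hK h3 hX (by omega) hw
      (fun i j hji hi => hmom _ (by have := hmono j (by omega); omega))
      fun i hi => hmom _ (by have := hmono i (by omega); omega)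
    rcases eq_or_ne (moment X w (k + 2 - 1 + q * (k + 2 - 1))) 0 with h0 | h0
    · exact ⟨N, Or.inl rfl, by convert this.1 h0 using 1; omega⟩
    · exact ⟨N + 1, Or.inr rfl, by convert this.2 h0 using 1; omega⟩

end Lengths

/-! ### Roots of unity together with zero, beyond the first non-vanishing moment -/

section UnitRoots

/-- The weight `-m` at zero and the weight one at the `m`-th roots of unity. -/
noncomputable def unitRootWeight (K : Type*) [Field K] (m : ℕ) (a : K) : K := by
  classical
  exact if a = 0 then -m else 1

theorem moment_unitRootWeight {K : Type*} [Field K] [DecidableEq K] {m : ℕ} (hm : 0 < m) {ζ : K}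
    (hζ : IsPrimitiveRoot ζ m) {e : ℕ} (he : m ∣ e → e = 0) :
    moment (insert 0 (Polynomial.nthRootsFinset m (1 : K))) (unitRootWeight K m) e = 0 := by
  have h0 : (0 : K) ∉ Polynomial.nthRootsFinset m (1 : K) := fun h => by
    have := (Polynomial.mem_nthRootsFinset hm 1).mp h
    rw [zero_pow hm.ne'] at this
    exact zero_ne_one this
  have h1 : ∑ a ∈ Polynomial.nthRootsFinset m (1 : K), unitRootWeight K m a * a ^ e
      = ∑ a ∈ Polynomial.nthRootsFinset m (1 : K), a ^ e :=
    Finset.sum_congr rfl fun a ha => by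
      have ha0 : a ≠ 0 := fun h => h0 (by rwa [h] at ha)
      rw [unitRootWeight, if_neg ha0, one_mul]
  rw [moment, Finset.sum_insert h0, h1, unitRootWeight, if_pos rfl]
  rcases Nat.eq_zero_or_pos e with rfl | hpos
  · simp [hζ.card_nthRootsFinset]
  · rw [zero_pow hpos.ne', mul_zero, zero_add]
    have hζe : ζ ^ e ≠ 1 := fun h => hpos.ne' (he ((hζ.pow_eq_one_iff_dvd e).mp h))
    have hζ0 : ζ ≠ 0 := hζ.ne_zero hm.ne'
    -- multiplication by `ζ` permutes the roots of unity
    have h2 : ∑ a ∈ Polynomial.nthRootsFinset m (1 : K), (ζ * a) ^ e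
        = ∑ a ∈ Polynomial.nthRootsFinset m (1 : K), a ^ e := by
      refine Finset.sum_bij' (fun a _ => ζ * a) (fun a _ => ζ⁻¹ * a) ?_ ?_ ?_ ?_ ?_
      · intro a ha
        rw [Polynomial.mem_nthRootsFinset hm] at ha ⊢
        rw [mul_pow, ha, hζ.pow_eq_one, one_mul]
      · intro a ha
        rw [Polynomial.mem_nthRootsFinset hm] at ha ⊢
        rw [mul_pow, inv_pow, ha, hζ.pow_eq_one, inv_one, one_mul]
      · intro a _; rw [inv_mul_cancel_left₀ hζ0]
      · intro a _; rw [mul_inv_cancel_left₀ hζ0]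
      · intro a _; rfl
    simp_rw [mul_pow] at h2
    rw [← Finset.mul_sum] at h2
    by_contra hne
    exact hζe (mul_right_cancel₀ hne (h2.trans (one_mul _).symm))

/-- An exponent `i + q j` with `j < i ≤ k + 1` is not a multiple of `m`, unless it is equal to
`m` with `i = j + 2`. Multiplication by `q` exchanges `i` and `j` modulo `m`, so that in this
case `m` divides `2 (q - 1)`, and the bounds leave one possibility. -/
theorem not_dvd_exponent {q m k : ℕ} (hq : 1 < q) (hm : m ∣ q ^ 2 - 1) (hlo : m ≤ k * (q + 1))
    (hhi : k * (q + 1) ≤ m + q) (hk : ¬ m ∣ k * (q + 1)) (hmk : 2 * k + q ≤ m + 1)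
    (hex : ¬ (q = 5 ∧ m = 8)) {i j : ℕ} (hji : j < i) (hi : i ≤ k + 1) : ¬ m ∣ i + q * j := by
  intro hdvd
  have hA : k * (q + 1) = q * k + k := by ring
  have hne : m ≠ k * (q + 1) := fun h => hk (h ▸ dvd_rfl)
  rw [hA] at hlo hhi hne
  have hk0 : k ≠ 0 := by rintro rfl; omega
  have hq2 : 1 ≤ q ^ 2 := Nat.one_le_pow _ _ (by omega)
  rcases (by omega : j = k ∨ j + 1 = k ∨ j + 2 ≤ k) with rfl | rfl | hj
  · obtain rfl : i = j + 1 := by omega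
    obtain ⟨c, hc⟩ := hdvd
    have hc2 : 2 ≤ c := by
      by_contra! h
      interval_cases c <;> omega
    have := Nat.mul_le_mul_left m hc2
    have hj1 : j = 1 := by omega
    subst hj1
    omega
  · have hexp : q * (j + 1) = q * j + q := by ring
    rw [hexp] at hlo hhi hne
    have hem : i + q * j = m := by
      obtain ⟨c, hc⟩ := hdvd
      have hc2 : c < 2 := by
        by_contra! h
        have := Nat.mul_le_mul_left m h
        omega
      interval_cases c <;> omega
    -- the conjugate exponent `j + q i` is a multiple of `m`, too
    have hconj : m ∣ j + q * i := by
      have h1 : q * (i + q * j) = j * (q ^ 2 - 1) + (j + q * i) := by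
        zify [hq2]; ring
      have h2 : m ∣ q * (i + q * j) := hem ▸ Dvd.intro_left q rfl
      rw [h1] at h2
      exact (Nat.dvd_add_right (hm.mul_left j)).mp h2
    rcases (by omega : i = j + 1 ∨ i = j + 2) with rfl | rfl
    · have h1 : j + q * (j + 1) = (j + 1 + q * j) + (q - 1) := by
        rw [hexp]; omega
      rw [h1, hem] at hconj
      have := Nat.le_of_dvd (by omega) ((Nat.dvd_add_right dvd_rfl).mp hconj)
      omega
    · have h1 : j + q * (j + 2) = (j + 2 + q * j) + 2 * (q - 1) := by
        have : q * (j + 2) = q * j + 2 * q := by ring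
        omega
      rw [h1, hem] at hconj
      obtain ⟨c, hc⟩ := (Nat.dvd_add_right dvd_rfl).mp hconj
      have hc1 : c = 1 := by
        have : c < 2 := by
          by_contra! h
          have := Nat.mul_le_mul_left m h
          omega
        interval_cases c <;> omega
      subst hc1
      have hj2 : j < 2 := by
        by_contra! h
        have := Nat.mul_le_mul_left q h
        omega
      interval_cases j
      · obtain rfl : q = 2 := by omega
        obtain rfl : m = 2 := by omega
        norm_num at hm
      · exact hex ⟨by omega, by omega⟩
  · have := Nat.mul_le_mul_left q hj
    have hexp : q * (j + 2) = q * j + 2 * q := by ring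
    have := Nat.le_of_dvd (by omega) hdvd
    omega

end UnitRoots

/-! ### The extension field, and the conclusion -/

section Conclusion

theorem exists_quadratic_extension {q : ℕ} (hq : IsPrimePow q) :
    ∃ (F K : Type) (_ : Field F) (_ : Fintype F) (_ : Field K) (_ : Fintype K) (_ : Algebra F K),
      Fintype.card F = q ∧ Fintype.card K = q ^ 2 := by
  obtain ⟨p, m, hp, hm, rfl⟩ := hq
  have : Fact p.Prime := ⟨hp.nat_prime⟩
  have hF : Nat.card (GaloisField p m) = p ^ m := GaloisField.card p m hm.ne'
  let := Fintype.ofFinite (GaloisField p m)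
  let := Fintype.ofFinite (FiniteField.Extension (GaloisField p m) p 2)
  refine ⟨GaloisField p m, FiniteField.Extension (GaloisField p m) p 2, inferInstance,
    inferInstance, inferInstance, inferInstance, inferInstance, ?_, ?_⟩
  · rw [← Nat.card_eq_fintype_card, hF]
  · rw [← Nat.card_eq_fintype_card, FiniteField.natCard_extension, hF]

/-- The monomials of degree at most `k + 1` on zero and the `m`-th roots of unity. -/
theorem existsQuantumMDSCode_of_unitRoots (F : Type*) {K : Type*} [Field F] [Fintype F] [Field K]
    [Algebra F K] [Fintype K] {q m k : ℕ} (hF : Fintype.card F = q)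
    (hK : Fintype.card K = q ^ 2) (hm : m ∣ q ^ 2 - 1) (hlo : m ≤ k * (q + 1))
    (hhi : k * (q + 1) ≤ m + q) (hk : ¬ m ∣ k * (q + 1)) (hk' : ¬ m ∣ (k + 1) * (q + 1))
    (hmk : 2 * k + q ≤ m + 1) (hex : ¬ (q = 5 ∧ m = 8)) :
    ExistsQuantumMDSCode q (m + 1) (m + 1 - 2 * (k + 2)) (k + 3) := by
  classical
  have hq : 1 < q := hF ▸ Fintype.one_lt_card
  have hm0 : 0 < m := by omega
  have hk0 : k ≠ 0 := by rintro rfl; simp at hk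
  obtain ⟨ζ, hζ⟩ := exists_isPrimitiveRoot_of_dvd (K := K) (hK ▸ hm)
  have hqK : (q : K) = 0 := by
    rw [← map_natCast (algebraMap F K), ← hF, FiniteField.cast_card_eq_zero, map_zero]
  have hmK : (m : K) ≠ 0 := by
    obtain ⟨c, hc⟩ := hm
    intro h
    have h1 : q ^ 2 = m * c + 1 := by
      have := Nat.one_le_pow 2 q (by omega)
      omega
    have h2 := congrArg (Nat.cast : ℕ → K) h1
    push_cast at h2
    rw [hqK, h] at h2
    simp at h2
  have h0 : (0 : K) ∉ Polynomial.nthRootsFinset m (1 : K) := fun h => by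
    have := (Polynomial.mem_nthRootsFinset hm0 1).mp h
    rw [zero_pow hm0.ne'] at this
    exact zero_ne_one this
  have hX : (insert 0 (Polynomial.nthRootsFinset m (1 : K))).card = m + 1 := by
    rw [Finset.card_insert_of_notMem h0, hζ.card_nthRootsFinset]
  have hw : ∀ a : K, unitRootWeight K m a ≠ 0 ∧
      unitRootWeight K m a ^ q = unitRootWeight K m a := by
    intro a
    rw [unitRootWeight]
    split_ifs
    · refine ⟨neg_ne_zero.mpr hmK, ?_⟩
      rw [neg_pow_card_field F hF, ← map_natCast (algebraMap F K),
        algebraMap_pow_card_field F hF]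
    · exact ⟨one_ne_zero, one_pow q⟩
  refine (existsQuantumMDSCode_of_moments F hF hK (k := k + 2) (by omega) hX (by omega)
    (fun a _ => hw a) (fun i j hji hi => ?_) fun i hi => ?_).1 ?_
  · exact moment_unitRootWeight hm0 hζ fun h =>
      absurd h (not_dvd_exponent hq hm hlo hhi hk hmk hex hji (by omega))
  · refine moment_unitRootWeight hm0 hζ fun h => ?_
    have hexp : i + q * i = i * (q + 1) := by ring
    rw [hexp] at h ⊢
    rcases (by omega : i = k ∨ i + 1 ≤ k) with rfl | hik
    · exact absurd h hk
    · by_contra hne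
      have h1 := Nat.le_of_dvd (Nat.pos_of_ne_zero hne) h
      have h2 := Nat.mul_le_mul_right (q + 1) hik
      have h3 : (i + 1) * (q + 1) = i * (q + 1) + (q + 1) := by ring
      omega
  · refine moment_unitRootWeight hm0 hζ fun h => absurd h ?_
    have hexp : k + 2 - 1 + q * (k + 2 - 1) = (k + 1) * (q + 1) := by
      rw [show k + 2 - 1 = k + 1 by omega]; ring
    rwa [hexp]

end Conclusion

theorem theoremQ (q : ℕ) (hq : IsPrimePow q) :
    (∀ N k : ℕ, 1 ≤ k → k ≤ (N + q - 1) / (q + 1) → AdmissibleLength q N →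
      ExistsQuantumMDSCode q N (N - 2 * k) (k + 1) ∧
      (k * (q + 1) = N - 1 →
        ExistsQuantumMDSCode q (N + 1) (N - 2 * k - 1) (k + 2)) ∧
      (k * (q + 1) ≠ N - 1 + q → k * (q + 1) ≠ N - 1 →
        ∃ N' : ℕ, (N' = N ∨ N' = N + 1) ∧
          ExistsQuantumMDSCode q N' (N' - 2 * k - 2) (k + 2))) ∧
    (∀ n k₀ : ℕ, (n - 1) ∣ (q ^ 2 - 1) → k₀ = (n + q - 1) / (q + 1) →
      ¬ (n - 1) ∣ k₀ * (q + 1) → ¬ (n - 1) ∣ (k₀ + 1) * (q + 1) → 2 * k₀ + q ≤ n →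
        ∃ n' : ℕ, (n' = n ∨ n' = n + 1) ∧
          ExistsQuantumMDSCode q n' (n' - 2 * (k₀ + 2)) (k₀ + 3)) := by
  obtain ⟨F, K, _, _, _, _, _, hF, hK⟩ := exists_quadratic_extension hq
  refine ⟨fun N k hk hkN hN => ?_, fun n k₀ hn hk₀ h1 h2 h3 => ?_⟩
  · exact (hN.isLagrangeLength (K := K) F hF hK).existsQuantumMDSCode F hF hK hk
      ((Nat.le_div_iff_mul_le (by omega)).mp hkN)
  · refine ⟨n, Or.inl rfl, ?_⟩
    have hq1 := hq.one_lt
    obtain ⟨m, rfl⟩ : ∃ m, n = m + 1 := ⟨n - 1, by omega⟩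
    rw [Nat.add_sub_cancel] at hn h1 h2
    have hlo := Nat.lt_mul_div_succ (m + 1 + q - 1) (b := q + 1) (by omega)
    have hhi := Nat.div_mul_le_self (m + 1 + q - 1) (q + 1)
    rw [← hk₀] at hlo hhi
    rw [mul_comm, add_mul, one_mul] at hlo
    by_cases hex : q = 5 ∧ m = 8
    · obtain ⟨rfl, rfl⟩ := hex
      obtain rfl : k₀ = 2 := hk₀
      exact existsQuantumMDSCode_nine
    · exact existsQuantumMDSCode_of_unitRoots F hF hK hn (by omega) (by omega) h1 h2 h3 hex
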